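/- \textbf{Setting.} Let $\mathcal H$ be a separable complex Hilbert space, $\mathcal N$ a bounded self-adjoint operator on $\mathcal H$ with spectrum $\sigma(\mathcal N)\subset\mathbb R$ and spectral projections $\Pi(\cdot)$, and $\rho$ a density matrix on $\mathcal H$ (positive, trace class, $\operatorname{tr}\rho=1$). Let $\lambda_\rho$ be the spectral measure of $\mathcal N$ in the state $\rho$, i.e. $\operatorname{tr}(g(\mathcal N)\rho)=\int g\,d\lambda_\rho$ for bounded Borel functions $g$. Let $(\mathcal X,\Sigma_P,\mu)$ be a $\sigma$-finite measure space and $(\xi,\nu)\mapsto V_\xi(\nu)\in\mathbb C$ a measurable function on $\mathcal X\times\mathbb R$ such that each $V_\xi$ is bounded and $\int_{\mathcal X}|V_\xi(\nu)|^2\,d\mu(\xi)=1$ for all $\nu\in\mathbb R$. Put $V_\xi=V_\xi(\mathcal N)$ (Borel functional calculus), and, for $\underline\xi=(\xi_1,\xi_2,\dots)\in\Xi=\mathcal X^{\mathbb N}$, $V_k=V_{\xi_k}\cdots V_{\xi_1}$ and $\rho_k=V_k\rho V_k^*/\operatorname{tr}(V_k\rho V_k^*)$. Let $\mathbb P_\rho$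 be the probability measure on $\Xi$ (with the product $\sigma$-algebra) under which, for every $k$, $(\xi_1,\dots,\xi_k)$ has density $\operatorname{tr}(V_k\rho V_k^*)$ with respect to $\mu^{\otimes k}$. Let $f(\xi|\nu)=|V_\xi(\nu)|^2$, $d\mu_\nu=f(\cdot|\nu)\,d\mu$, $l(\nu|\xi)=\log f(\xi|\nu)\in[-\infty,\infty)$ and $l_k(\nu)=\frac1k\sum_{j=1}^k l(\nu|\xi_j)$. For $k\ge1$ let $\hat{\mathcal N}_k=\hat{\mathcal N}_k(\underline\xi)\in\sigma(\mathcal N)$ be any measurable choice of a maximizer of $l_k$ over $\sigma(\mathcal N)$ (maximum-likelihood estimator). For $\nu\in\sigma(\mathcal N)$ and a nonempty closed set $N\subset\sigma(\mathcal N)$ let $$S(\nu|N)=\min_{\nu'\in N}\int_{\mathcal X}\big(l(\nu|\xi)-l(\nu'|\xi)\big)\,d\mu_\nu(\xi)$$ be the relative entropy. \textbf{Assumption.} (0) $f(\cdot|\nu)\in L^1(\mathcal X,\mu)$ for $\nu\in\sigma(\mathcal N)$. (1) Identifiability: for $\nu\ne\nu'$ in $\sigma(\mathcal N)$, $f(\cdot|\nu)$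 and $f(\cdot|\nu')$ are different elements of $L^1(\mathcal X,\mu)$. (2) Continuity: for every $\xi\in\mathcal X$, $\nu\mapsto f(\xi|\nu)$ is continuous on $\sigma(\mathcal N)$. (3) Dominance: $\sup_{\nu'\in\sigma(\mathcal N)}|l(\nu'|\cdot)|\in L^1(\mathcal X,\mu_\nu)$ for every $\nu\in\sigma(\mathcal N)$ (with $|-\infty|=\infty$). \textbf{Theorem.} Under this assumption the measure $\mathbb P_\rho$ exists, and there is a random variable $\hat{\mathcal N}_\infty$ on $\Xi$ such that $\hat{\mathcal N}_k\to\hat{\mathcal N}_\infty$ $\mathbb P_\rho$-almost surely and, for every Borel set $N\subset\mathbb R$, $$\mathbb P_\rho\big(\hat{\mathcal N}_\infty\in N\big)=\operatorname{tr}(\Pi(N)\rho).$$ Furthermore, if $N=\overline O$ is the closure of a nonempty relatively open subset $O$ of $\sigma(\mathcal N)$ and $N\subset\operatorname{supp}\lambda_\rho$, then, $\mathbb P_\rho$-almost surely, $\operatorname{tr}(\Pi(N)\rho_k)>0$ for all $k$ and $$-\lim_{k\to\infty}\frac1k\log\operatorname{tr}(\Pi(N)\rho_k)=S(\hat{\mathcal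 N}_\infty|N).$$ -/

import Mathlib

open MeasureTheory Filter Topology
open scoped ENNReal NNReal InnerProductSpace

namespace NonDemolition

set_option linter.unusedSimpArgs false

variable {H : Type*} [NormedAddCommGroup H] [InnerProductSpace ℂ H] [CompleteSpace H]

/-- `f ↦ ⟨x, f(N) x⟩` on continuous functions on the spectrum. -/
noncomputable def spectralFunctional (N : H →L[ℂ] H) (hN : IsSelfAdjoint N) (x : H) :
    CompactlySupportedContinuousMap (spectrum ℝ N) ℝ →ₚ[ℝ] ℝ :=
  PositiveLinearMap.mk₀
    { toFun := fun f => (⟪x, cfcHom hN f.toContinuousMap x⟫_ℂ).re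
      map_add' := fun f g => by
        have : (f + g).toContinuousMap = f.toContinuousMap + g.toContinuousMap := rfl
        simp [this]
      map_smul' := fun c f => by
        have : (c • f).toContinuousMap = c • f.toContinuousMap := rfl
        simp [this] }
    (fun f hf => by
      have h : 0 ≤ cfcHom hN f.toContinuousMap := (cfcHom_nonneg_iff hN).2 (fun t => hf t)
      have h2 := (ContinuousLinearMap.nonneg_iff_isPositive _).1 h
      exact h2.re_inner_nonneg_right x)

/-- The spectral measure `μ_x` of the self-adjoint operator `N` at the vector `x`, carried by the
spectrum of `N`: the Riesz measure with `∫ f dμ_x = ⟨x, f(N) x⟩` for continuous `f`. -/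
noncomputable def vectorSpectralMeasure (N : H →L[ℂ] H) (hN : IsSelfAdjoint N) (x : H) :
    Measure ℝ :=
  (RealRMK.rieszMeasure (spectralFunctional N hN x)).map Subtype.val

theorem compactSpace_spectrum (N : H →L[ℂ] H) : CompactSpace (spectrum ℝ N) :=
  isCompact_iff_compactSpace.1 (spectrum.isCompact N)

instance isFiniteMeasure_vectorSpectralMeasure (N : H →L[ℂ] H) (hN : IsSelfAdjoint N) (x : H) :
    IsFiniteMeasure (vectorSpectralMeasure N hN x) := by
  have := compactSpace_spectrum N
  unfold vectorSpectralMeasure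
  have : IsFiniteMeasure (RealRMK.rieszMeasure (spectralFunctional N hN x)) :=
    ⟨isCompact_univ.measure_lt_top⟩
  infer_instance

theorem integral_vectorSpectralMeasure (N : H →L[ℂ] H) (hN : IsSelfAdjoint N) (x : H)
    (f : C(ℝ, ℝ)) :
    ∫ t, f t ∂(vectorSpectralMeasure N hN x) =
      (⟪x, cfcHom hN (f.restrict (spectrum ℝ N)) x⟫_ℂ).re := by
  have := compactSpace_spectrum N
  unfold vectorSpectralMeasure
  rw [integral_map (by fun_prop) (by fun_prop)]
  exact RealRMK.integral_rieszMeasure (spectralFunctional N hN x)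
    (CompactlySupportedContinuousMap.continuousMapEquiv (f.restrict (spectrum ℝ N)))

theorem measureReal_vectorSpectralMeasure_univ (N : H →L[ℂ] H) (hN : IsSelfAdjoint N) (x : H) :
    (vectorSpectralMeasure N hN x).real Set.univ = ‖x‖ ^ 2 := by
  have h := integral_vectorSpectralMeasure N hN x 1
  have h1 : (1 : C(ℝ, ℝ)).restrict (spectrum ℝ N) = 1 := rfl
  rw [h1, map_one] at h
  simpa [inner_self_eq_norm_sq_to_K, ← Complex.ofReal_pow] using h

theorem integrable_vectorSpectralMeasure (N : H →L[ℂ] H) (hN : IsSelfAdjoint N) (x : H)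
    {g : ℝ → ℂ} (hg : Measurable g) {C : ℝ} (hC : ∀ t, ‖g t‖ ≤ C) :
    Integrable g (vectorSpectralMeasure N hN x) :=
  Integrable.of_bound hg.aestronglyMeasurable C (Eventually.of_forall hC)

/-- A real linear relation between the quadratic forms `x ↦ ⟨x, T x⟩` that holds for all bounded
operators `T` passes to the spectral measures. -/
theorem sum_integral_eq_zero (N : H →L[ℂ] H) (hN : IsSelfAdjoint N) {g : ℝ → ℂ}
    (hg : Measurable g) {C : ℝ} (hC : ∀ t, ‖g t‖ ≤ C) {n : ℕ} (c : Fin n → ℝ) (u : Fin n → H)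
    (h : ∀ T : H →L[ℂ] H, ∑ i, (c i : ℂ) * ⟪u i, T (u i)⟫_ℂ = 0) :
    ∑ i, (c i : ℂ) * ∫ t, g t ∂(vectorSpectralMeasure N hN (u i)) = 0 := by
  have key : ∑ i, (c i).toNNReal • vectorSpectralMeasure N hN (u i) =
      ∑ i, (-c i).toNNReal • vectorSpectralMeasure N hN (u i) := by
    apply ext_of_forall_integral_eq_of_IsFiniteMeasure
    intro f
    have hf : ∀ i, Integrable f (vectorSpectralMeasure N hN (u i)) := fun i => f.integrable _
    rw [integral_finsetSum_measure (fun i _ => (hf i).smul_measure_nnreal),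
      integral_finsetSum_measure (fun i _ => (hf i).smul_measure_nnreal), ← sub_eq_zero,
      ← Finset.sum_sub_distrib]
    have h0 := congrArg Complex.re (h (cfcHom hN (f.toContinuousMap.restrict (spectrum ℝ N))))
    simp only [Complex.re_sum, Complex.re_ofReal_mul, Complex.zero_re] at h0
    rw [← h0]
    refine Finset.sum_congr rfl fun i _ => ?_
    have h1 := integral_vectorSpectralMeasure N hN (u i) f.toContinuousMap
    have h2 : ((c i).toNNReal : ℝ) - ((-c i).toNNReal : ℝ) = c i := by
      simp only [Real.coe_toNNReal', max_zero_sub_max_neg_zero_eq_self]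
    rw [integral_smul_nnreal_measure, integral_smul_nnreal_measure, NNReal.smul_def,
      NNReal.smul_def, ← sub_smul, h2, smul_eq_mul, ← h1]
    rfl
  have h2 := congrArg (fun m => ∫ t, g t ∂m) key
  have hi : ∀ i, Integrable g (vectorSpectralMeasure N hN (u i)) :=
    fun i => integrable_vectorSpectralMeasure N hN _ hg hC
  rw [integral_finsetSum_measure (fun i _ => (hi i).smul_measure_nnreal),
      integral_finsetSum_measure (fun i _ => (hi i).smul_measure_nnreal), ← sub_eq_zero,
      ← Finset.sum_sub_distrib] at h2
  rw [← h2]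
  refine Finset.sum_congr rfl fun i _ => ?_
  have h2 : ((c i).toNNReal : ℝ) - ((-c i).toNNReal : ℝ) = c i := by
    simp only [Real.coe_toNNReal', max_zero_sub_max_neg_zero_eq_self]
  rw [integral_smul_nnreal_measure, integral_smul_nnreal_measure, NNReal.smul_def,
    NNReal.smul_def, ← sub_smul, h2, Complex.real_smul]

/-- The bounded quadratic form `x ↦ ∫ g dμ_x` comes from a bounded operator. -/
theorem exists_borelCalculus (N : H →L[ℂ] H) (hN : IsSelfAdjoint N) {g : ℝ → ℂ}
    (hg : Measurable g) {C : ℝ} (hC : ∀ t, ‖g t‖ ≤ C) :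
    ∃ A : H →L[ℂ] H, ∀ x, ⟪x, A x⟫_ℂ = ∫ t, g t ∂(vectorSpectralMeasure N hN x) := by
  set Q : H → ℂ := fun x => ∫ t, g t ∂(vectorSpectralMeasure N hN x) with hQ
  have key : ∀ {n : ℕ} (c : Fin n → ℝ) (u : Fin n → H)
      (_ : ∀ T : H →L[ℂ] H, ∑ i, (c i : ℂ) * ⟪u i, T (u i)⟫_ℂ = 0),
      ∑ i, (c i : ℂ) * Q (u i) = 0 := fun c u h => sum_integral_eq_zero N hN hg hC c u h
  have hQb : ∀ x, ‖Q x‖ ≤ C * ‖x‖ ^ 2 := fun x => by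
    have := norm_integral_le_of_norm_le_const (μ := vectorSpectralMeasure N hN x)
      (Eventually.of_forall hC)
    rwa [measureReal_vectorSpectralMeasure_univ] at this
  have hC0 : 0 ≤ C := (norm_nonneg _).trans (hC 0)
  set D : H → H → ℂ := fun x y => Q (x + y) - Q (x - y) with hD
  have hDl : ∀ x x' y, D (x + x') y = D x y + D x' y := fun x x' y => by
    have := key ![1, -1, -1, 1, -1, 1] ![x + x' + y, x + x' - y, x + y, x - y, x' + y, x' - y]
      (fun T => by
        simp [Fin.sum_univ_succ, inner_add_left, inner_add_right, inner_sub_left, inner_sub_right]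
        ring)
    simp [Fin.sum_univ_succ] at this
    simp only [hD]
    linear_combination this
  have hDr : ∀ x y y', D x (y + y') = D x y + D x y' := fun x y y' => by
    have := key ![1, -1, -1, 1, -1, 1] ![x + (y + y'), x - (y + y'), x + y, x - y, x + y', x - y']
      (fun T => by
        simp [Fin.sum_univ_succ, inner_add_left, inner_add_right, inner_sub_left, inner_sub_right]
        ring)
    simp [Fin.sum_univ_succ] at this
    simp only [hD]
    linear_combination this
  have hDsr : ∀ (a b : ℝ) x y, D x ((a + b * Complex.I : ℂ) • y) =
      a * D x y + b * D x (Complex.I • y) := fun a b x y => by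
    have := key ![1, -1, -a, a, -b, b] ![x + (a + b * Complex.I : ℂ) • y,
        x - (a + b * Complex.I : ℂ) • y, x + y, x - y, x + Complex.I • y, x - Complex.I • y]
      (fun T => by
        simp [Fin.sum_univ_succ, inner_add_left, inner_add_right, inner_sub_left, inner_sub_right,
          inner_smul_left, inner_smul_right]
        ring)
    simp [Fin.sum_univ_succ] at this
    simp only [hD]
    linear_combination this
  have hDsl : ∀ (a b : ℝ) x y, D ((a + b * Complex.I : ℂ) • x) y =
      a * D x y - b * D x (Complex.I • y) := fun a b x y => by
    have := key ![1, -1, -a, a, b, -b] ![(a + b * Complex.I : ℂ) • x + y,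
        (a + b * Complex.I : ℂ) • x - y, x + y, x - y, x + Complex.I • y, x - Complex.I • y]
      (fun T => by
        simp [Fin.sum_univ_succ, inner_add_left, inner_add_right, inner_sub_left, inner_sub_right,
          inner_smul_left, inner_smul_right]
        ring)
    simp [Fin.sum_univ_succ] at this
    simp only [hD]
    linear_combination this
  have hDn : ∀ x y, D x (-y) = - D x y := fun x y => by
    simp only [hD, sub_neg_eq_add, ← sub_eq_add_neg]; ring
  set B : H → H → ℂ := fun x y => (D x y - Complex.I * D x (Complex.I • y)) / 4 with hB
  have hBsr : ∀ (c : ℂ) x y, B x (c • y) = c * B x y := fun c x y => by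
    have h1 := hDsr c.re c.im x y
    have h2 := hDsr c.re c.im x (Complex.I • y)
    rw [Complex.re_add_im] at h1 h2
    rw [smul_comm c, smul_smul Complex.I Complex.I, Complex.I_mul_I, neg_one_smul, hDn] at h2
    simp only [hB]
    rw [h1, h2]
    linear_combination (c.im * D x (Complex.I • y) / 4) * Complex.I_sq +
      ((D x y - Complex.I * D x (Complex.I • y)) / 4) * Complex.re_add_im c
  have hBsl : ∀ (c : ℂ) x y, B (c • x) y = (starRingEnd ℂ) c * B x y := fun c x y => by
    have h1 := hDsl c.re c.im x y
    have h2 := hDsl c.re c.im x (Complex.I • y)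
    rw [Complex.re_add_im] at h1 h2
    rw [smul_smul, Complex.I_mul_I, neg_one_smul, hDn] at h2
    have h3 : (starRingEnd ℂ) c = c.re - c.im * Complex.I := by
      apply Complex.ext <;> simp
    simp only [hB]
    rw [h1, h2, h3]
    linear_combination (-c.im * D x (Complex.I • y) / 4) * Complex.I_sq
  have hBd : ∀ x, B x x = Q x := fun x => by
    have h1 := key ![1, -1, -4] ![x + x, x - x, x] (fun T => by
        simp [Fin.sum_univ_succ, inner_add_left, inner_add_right]
        ring)
    have h2 := key ![1, -1] ![x + Complex.I • x, x - Complex.I • x] (fun T => by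
        simp [Fin.sum_univ_succ, inner_add_left, inner_add_right, inner_sub_left, inner_sub_right,
          inner_smul_left, inner_smul_right]
        ring)
    simp [Fin.sum_univ_succ] at h1 h2
    simp only [hB, hD, sub_self]
    linear_combination h1 / 4 - Complex.I / 4 * h2
  have hDb : ∀ x y, ‖D x y‖ ≤ 2 * C * (‖x‖ ^ 2 + ‖y‖ ^ 2) := fun x y => by
    have h1 := parallelogram_law_with_norm ℂ x y
    have h2 := norm_sub_le (Q (x + y)) (Q (x - y))
    have h3 := hQb (x + y)
    have h4 := hQb (x - y)
    simp only [hD]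
    nlinarith
  have hBb1 : ∀ x y, ‖B x y‖ ≤ C * (‖x‖ ^ 2 + ‖y‖ ^ 2) := fun x y => by
    have h1 := hDb x y
    have h2 := hDb x (Complex.I • y)
    have h3 := norm_sub_le (D x y) (Complex.I * D x (Complex.I • y))
    rw [norm_smul, Complex.norm_I, one_mul] at h2
    rw [norm_mul, Complex.norm_I, one_mul] at h3
    simp only [hB, norm_div, Complex.norm_ofNat]
    linarith
  have hBb : ∀ x y, ‖B x y‖ ≤ 2 * C * ‖x‖ * ‖y‖ := fun x y => by
    rcases eq_or_ne x 0 with rfl | hx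
    · have := hBsl 0 0 y
      simp at this
      simp [this]
    rcases eq_or_ne y 0 with rfl | hy
    · have := hBsr 0 x 0
      simp at this
      simp [this]
    have hx' : 0 < ‖x‖ := norm_pos_iff.2 hx
    have hy' : 0 < ‖y‖ := norm_pos_iff.2 hy
    have h1 := hBb1 (((‖x‖⁻¹ : ℝ) : ℂ) • x) (((‖y‖⁻¹ : ℝ) : ℂ) • y)
    rw [hBsl, hBsr, norm_smul, norm_smul, norm_mul, norm_mul, RCLike.norm_conj, Complex.norm_real,
      Complex.norm_real, norm_inv, norm_inv, norm_norm, norm_norm, inv_mul_cancel₀ hx'.ne',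
      inv_mul_cancel₀ hy'.ne'] at h1
    rw [← mul_assoc, ← mul_inv, inv_mul_le_iff₀ (by positivity)] at h1
    linarith
  let L : H →ₗ⋆[ℂ] H →ₗ[ℂ] ℂ := LinearMap.mk₂'ₛₗ (starRingEnd ℂ) (RingHom.id ℂ) B
    (fun x x' y => by simp only [hB, hDl]; ring)
    (fun c x y => hBsl c x y)
    (fun x y y' => by simp only [hB, hDr, smul_add]; ring)
    (fun c x y => hBsr c x y)
  let L' : H →L⋆[ℂ] H →L[ℂ] ℂ := L.mkContinuous₂ (2 * C) hBb
  refine ⟨ContinuousLinearMap.adjoint (InnerProductSpace.continuousLinearMapOfBilin L'), fun x => ?_⟩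
  rw [ContinuousLinearMap.adjoint_inner_right,
    InnerProductSpace.continuousLinearMapOfBilin_apply]
  exact hBd x

open Classical in
/-- Bounded Borel functional calculus: `g(N)` is the bounded operator with
`⟨x, g(N) x⟩ = ∫ g dμ_x` for all vectors `x`; for bounded Borel functions `g` it exists by
`inner_borelCalculus`. -/
noncomputable def borelCalculus (N : H →L[ℂ] H) (hN : IsSelfAdjoint N) (g : ℝ → ℂ) : H →L[ℂ] H :=
  if h : ∃ A : H →L[ℂ] H, ∀ x, ⟪x, A x⟫_ℂ = ∫ t, g t ∂(vectorSpectralMeasure N hN x)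
  then h.choose else 0

theorem inner_borelCalculus (N : H →L[ℂ] H) (hN : IsSelfAdjoint N) {g : ℝ → ℂ}
    (hg : Measurable g) {C : ℝ} (hC : ∀ t, ‖g t‖ ≤ C) (x : H) :
    ⟪x, borelCalculus N hN g x⟫_ℂ = ∫ t, g t ∂(vectorSpectralMeasure N hN x) := by
  have h := exists_borelCalculus N hN hg hC
  rw [borelCalculus, dif_pos h]
  exact h.choose_spec x

/-- The spectral projection `Π(B)` of `N` associated with a Borel set `B`. -/
noncomputable def spectralProjection (N : H →L[ℂ] H) (hN : IsSelfAdjoint N) (B : Set ℝ) :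
    H →L[ℂ] H :=
  borelCalculus N hN (B.indicator fun _ => 1)

variable (H) in
/-- The index set of the orthonormal basis used to compute traces. -/
def basisIndex : Set H := (exists_hilbertBasis ℂ H).choose

variable (H) in
/-- A fixed orthonormal (Hilbert) basis of `H`. -/
noncomputable def onBasis : HilbertBasis (basisIndex H) ℂ H :=
  (exists_hilbertBasis ℂ H).choose_spec.choose

/-- The trace `∑ᵢ ⟨eᵢ, A eᵢ⟩`; it is only applied to trace class operators (products of a density
matrix with bounded operators), for which it does not depend on the orthonormal basis. -/
noncomputable def trace (A : H →L[ℂ] H) : ℂ :=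
  ∑' i, ⟪onBasis H i, A (onBasis H i)⟫_ℂ

/-- Density matrices: positive trace class operators of trace one. -/
structure IsDensityMatrix (ρ : H →L[ℂ] H) : Prop where
  isPositive : ρ.IsPositive
  hasSum_one : HasSum (fun i => ⟪onBasis H i, ρ (onBasis H i)⟫_ℂ) 1

/-- If `∑ⱼ ‖T eⱼ‖²` is finite for a symmetric `T`, then `∑ᵢ ⟨eᵢ, A T² eᵢ⟩ = ∑ⱼ ⟨T eⱼ, A T eⱼ⟩`. -/
theorem hasSum_inner_mul_sq {ι : Type*} (b : HilbertBasis ι ℂ H) (T A : H →L[ℂ] H)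
    (hTs : ∀ x y, ⟪T x, y⟫_ℂ = ⟪x, T y⟫_ℂ) (hn : Summable fun j => ‖T (b j)‖ ^ 2) :
    HasSum (fun j => ⟪T (b j), A (T (b j))⟫_ℂ) (∑' i, ⟪b i, A (T (T (b i)))⟫_ℂ) := by
  have hsq : ∀ v : H, HasSum (fun i => ‖⟪b i, v⟫_ℂ‖ ^ 2) (‖v‖ ^ 2) := fun v => by
    have h1 := Complex.hasSum_re (b.hasSum_inner_mul_inner v v)
    rw [inner_self_eq_norm_sq_to_K] at h1
    convert h1 using 2 with i
    · rw [← inner_conj_symm v (b i), ← Complex.normSq_eq_conj_mul_self, Complex.ofReal_re,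
        Complex.normSq_eq_norm_sq]
    · norm_cast
  have hdom : ∀ S : H →L[ℂ] H, Summable
      (fun p : ι × ι => ‖⟪b p.2, S (T (b p.1))⟫_ℂ‖ ^ 2) := fun S => by
    refine (summable_prod_of_nonneg (fun p => sq_nonneg _)).2 ⟨fun j => (hsq (S (T (b j)))).summable, ?_⟩
    have h0 : ∀ j, ∑' i, ‖⟪b i, S (T (b j))⟫_ℂ‖ ^ 2 = ‖S (T (b j))‖ ^ 2 :=
      fun j => (hsq (S (T (b j)))).tsum_eq
    simp only [h0]
    refine Summable.of_nonneg_of_le (fun j => sq_nonneg _) (fun j => ?_)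
      (hn.mul_left (‖S‖ ^ 2))
    rw [← mul_pow]
    gcongr
    exact S.le_opNorm _
  have hFs : Summable
      (fun p : ι × ι => ⟪T (b p.1), b p.2⟫_ℂ * ⟪b p.2, A (T (b p.1))⟫_ℂ) := by
    refine Summable.of_norm_bounded (((hdom 1).add (hdom A)).mul_left (1 / 2)) fun p => ?_
    rw [norm_mul, norm_inner_symm (T (b p.1)) (b p.2)]
    have h1 : (1 : H →L[ℂ] H) (T (b p.1)) = T (b p.1) := rfl
    rw [h1]
    nlinarith [sq_nonneg (‖⟪b p.2, T (b p.1)⟫_ℂ‖ - ‖⟪b p.2, A (T (b p.1))⟫_ℂ‖)]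
  have h1 : ∀ j, HasSum (fun i => ⟪T (b j), b i⟫_ℂ * ⟪b i, A (T (b j))⟫_ℂ)
      ⟪T (b j), A (T (b j))⟫_ℂ := fun j => b.hasSum_inner_mul_inner _ _
  have h2 : ∀ i, HasSum (fun j => ⟪T (b j), b i⟫_ℂ * ⟪b i, A (T (b j))⟫_ℂ)
      ⟪b i, A (T (T (b i)))⟫_ℂ := fun i => by
    have h3 := b.hasSum_inner_mul_inner (T (ContinuousLinearMap.adjoint A (b i))) (T (b i))
    rw [hTs, ContinuousLinearMap.adjoint_inner_left] at h3
    have h4 : (fun j => ⟪T (b j), b i⟫_ℂ * ⟪b i, A (T (b j))⟫_ℂ) = fun j =>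
        ⟪T (ContinuousLinearMap.adjoint A (b i)), b j⟫_ℂ * ⟪b j, T (b i)⟫_ℂ := by
      funext j
      rw [hTs (ContinuousLinearMap.adjoint A (b i)), ContinuousLinearMap.adjoint_inner_left,
        hTs (b j), mul_comm]
    rw [h4]
    exact h3
  have h5 := hFs.hasSum.prod_fiberwise h1
  have h6 := ((Equiv.prodComm ι ι).hasSum_iff.2 hFs.hasSum).prod_fiberwise h2
  rwa [h6.tsum_eq]

/-- For a density matrix `ρ` and a bounded operator `A`, `tr(A ρ) = ∑ⱼ ⟨√ρ eⱼ, A √ρ eⱼ⟩`. -/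
theorem hasSum_trace_mul {ρ : H →L[ℂ] H} (hρ : IsDensityMatrix ρ) :
    (HasSum (fun j => ‖CFC.sqrt ρ (onBasis H j)‖ ^ 2) 1) ∧ ∀ A : H →L[ℂ] H,
    HasSum (fun j => ⟪CFC.sqrt ρ (onBasis H j), A (CFC.sqrt ρ (onBasis H j))⟫_ℂ)
      (trace (A * ρ)) := by
  have hρ0 : 0 ≤ ρ := (ContinuousLinearMap.nonneg_iff_isPositive _).2 hρ.isPositive
  have hTT : ∀ x, ρ x = CFC.sqrt ρ (CFC.sqrt ρ x) := fun x => by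
    conv_lhs => rw [← CFC.sqrt_mul_sqrt_self ρ hρ0]
    rfl
  have hTs : ∀ x y, ⟪CFC.sqrt ρ x, y⟫_ℂ = ⟪x, CFC.sqrt ρ y⟫_ℂ :=
    ((ContinuousLinearMap.nonneg_iff_isPositive _).1 (CFC.sqrt_nonneg ρ)).isSymmetric
  have hn : HasSum (fun j => ‖CFC.sqrt ρ (onBasis H j)‖ ^ 2) 1 := by
    have h1 := Complex.hasSum_re hρ.hasSum_one
    simp only [Complex.one_re] at h1
    convert h1 using 2 with j
    rw [hTT, ← hTs, inner_self_eq_norm_sq_to_K]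
    norm_cast
  refine ⟨hn, fun A => ?_⟩
  have h := hasSum_inner_mul_sq (onBasis H) (CFC.sqrt ρ) A hTs hn.summable
  simp only [← hTT] at h
  exact h

/-- `m` is the spectral measure of `N` with respect to the state `ρ`:
`tr(g(N) ρ) = ∫ g dm` for all bounded Borel functions `g`. -/
def IsSpectralMeasure (N : H →L[ℂ] H) (hN : IsSelfAdjoint N) (ρ : H →L[ℂ] H) (m : Measure ℝ) :
    Prop :=
  IsFiniteMeasure m ∧ ∀ g : ℝ → ℂ, Measurable g → (∃ C : ℝ, ∀ t, ‖g t‖ ≤ C) →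
    trace (borelCalculus N hN g * ρ) = ∫ t, g t ∂m

theorem exists_isSpectralMeasure (N : H →L[ℂ] H) (hN : IsSelfAdjoint N) {ρ : H →L[ℂ] H}
    (hρ : IsDensityMatrix ρ) : ∃ m, IsSpectralMeasure N hN ρ m := by
  obtain ⟨hn, htr⟩ := hasSum_trace_mul hρ
  set m := Measure.sum fun j => vectorSpectralMeasure N hN (CFC.sqrt ρ (onBasis H j)) with hm
  have hfin : IsFiniteMeasure m := by
    refine ⟨?_⟩
    rw [hm, Measure.sum_apply _ MeasurableSet.univ]
    have h1 : ∀ j, vectorSpectralMeasure N hN (CFC.sqrt ρ (onBasis H j)) Set.univ =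
        ENNReal.ofReal (‖CFC.sqrt ρ (onBasis H j)‖ ^ 2) := fun j => by
      rw [← measureReal_vectorSpectralMeasure_univ N hN, ofReal_measureReal]
    simp only [h1]
    rw [← ENNReal.ofReal_tsum_of_nonneg (fun j => by positivity) hn.summable]
    exact ENNReal.ofReal_lt_top
  refine ⟨m, hfin, fun g hg ⟨C, hC⟩ => ?_⟩
  have hi : Integrable g m := Integrable.of_bound hg.aestronglyMeasurable C (Eventually.of_forall hC)
  have h1 := hasSum_integral_measure hi
  have h2 := htr (borelCalculus N hN g)
  simp only [inner_borelCalculus N hN hg hC] at h2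
  exact h2.unique h1

open Classical in
/-- The spectral measure `λ_ρ` of `N` with respect to the state `ρ`; for density matrices it exists
by `exists_isSpectralMeasure`. -/
noncomputable def stateSpectralMeasure (N : H →L[ℂ] H) (hN : IsSelfAdjoint N) (ρ : H →L[ℂ] H) :
    Measure ℝ :=
  if h : ∃ m, IsSpectralMeasure N hN ρ m then h.choose else 0

variable {X : Type*} [MeasurableSpace X]

/-- A measurable family `V_ξ` of bounded complex functions on `ℝ` with `∫ |V_ξ(ν)|² dμ(ξ) = 1` for
all `ν`. -/
structure IsJumpFamily (μ : Measure X) (V : X → ℝ → ℂ) : Prop where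
  measurable : Measurable (Function.uncurry V)
  bounded : ∀ ξ, ∃ C : ℝ, ∀ ν, ‖V ξ ν‖ ≤ C
  normalized : ∀ ν, ∫⁻ ξ, ENNReal.ofReal (‖V ξ ν‖ ^ 2) ∂μ = 1

/-- `V_k(ξ₁, …, ξ_k) = V_{ξ_k}(N) ⋯ V_{ξ_1}(N)`. -/
noncomputable def jumpProduct (N : H →L[ℂ] H) (hN : IsSelfAdjoint N) (V : X → ℝ → ℂ) {k : ℕ}
    (ξ : Fin k → X) : H →L[ℂ] H :=
  (List.ofFn fun i => borelCalculus N hN (V (ξ i))).reverse.prod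

/-- The unnormalized posterior state `V_k ρ V_k*`. -/
noncomputable def unnormalizedPosterior (N : H →L[ℂ] H) (hN : IsSelfAdjoint N) (V : X → ℝ → ℂ)
    (ρ : H →L[ℂ] H) {k : ℕ} (ξ : Fin k → X) : H →L[ℂ] H :=
  jumpProduct N hN V ξ * ρ * ContinuousLinearMap.adjoint (jumpProduct N hN V ξ)

/-- `P` is a law of the infinite sequence of outcomes: for every `k`, the law of the first `k`
outcomes is `tr(V_k ρ V_k*) dμ(ξ₁) ⋯ dμ(ξ_k)`. -/
def IsOutcomeLaw (N : H →L[ℂ] H) (hN : IsSelfAdjoint N) (μ : Measure X) [SigmaFinite μ]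
    (V : X → ℝ → ℂ) (ρ : H →L[ℂ] H) (P : Measure (ℕ → X)) : Prop :=
  ∀ (k : ℕ) (E : Set (Fin k → X)), MeasurableSet E →
    P {ξ | (fun i : Fin k => ξ i) ∈ E} =
      ∫⁻ ξ in E, ENNReal.ofReal (trace (unnormalizedPosterior N hN V ρ ξ)).re
        ∂(Measure.pi fun _ : Fin k => μ)

open Classical in
/-- The probability measure `ℙ_ρ` on the space of sequences of outcomes, determined by its
finite-dimensional distributions. -/
noncomputable def outcomeLaw (N : H →L[ℂ] H) (hN : IsSelfAdjoint N) (μ : Measure X) [SigmaFinite μ]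
    (V : X → ℝ → ℂ) (ρ : H →L[ℂ] H) : Measure (ℕ → X) :=
  if h : ∃ P, IsOutcomeLaw N hN μ V ρ P then h.choose else 0

/-- The posterior state `ρ_k = V_k ρ V_k* / tr(V_k ρ V_k*)` after the first `k` outcomes. -/
noncomputable def posterior (N : H →L[ℂ] H) (hN : IsSelfAdjoint N) (V : X → ℝ → ℂ)
    (ρ : H →L[ℂ] H) (k : ℕ) (ξ : ℕ → X) : H →L[ℂ] H :=
  (trace (unnormalizedPosterior N hN V ρ fun i : Fin k => ξ i))⁻¹ •
    unnormalizedPosterior N hN V ρ fun i : Fin k => ξ i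

/-- `f(ξ|ν) = |V_ξ(ν)|²`. -/
noncomputable def likelihood (V : X → ℝ → ℂ) (ξ : X) (ν : ℝ) : ℝ := ‖V ξ ν‖ ^ 2

/-- `l(ν|ξ) = log f(ξ|ν)`, with value `-∞` where `f(ξ|ν) = 0`. -/
noncomputable def logLikelihood (V : X → ℝ → ℂ) (ν : ℝ) (ξ : X) : EReal :=
  ENNReal.log (ENNReal.ofReal (likelihood V ξ ν))

/-- `l_k(ν|ξ) = (1/k) ∑_{j ≤ k} l(ν|ξ_j)`. -/
noncomputable def avgLogLikelihood (V : X → ℝ → ℂ) (k : ℕ) (ξ : ℕ → X) (ν : ℝ) : EReal :=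
  ((1 / k : ℝ) : EReal) * ∑ j ∈ Finset.range k, logLikelihood V ν (ξ j)

/-- `dμ_ν(ξ) = f(ξ|ν) dμ(ξ)`. -/
noncomputable def outcomeMeasure (μ : Measure X) (V : X → ℝ → ℂ) (ν : ℝ) : Measure X :=
  μ.withDensity fun ξ => ENNReal.ofReal (likelihood V ξ ν)

/-- Identifiability, continuity and dominance of the likelihood on the spectrum `σ`. -/
structure LikelihoodAssumption (μ : Measure X) (V : X → ℝ → ℂ) (σ : Set ℝ) : Prop where
  integrable : ∀ ν ∈ σ, Integrable (fun ξ => likelihood V ξ ν) μ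
  identifiable : ∀ ν ∈ σ, ∀ ν' ∈ σ, ν ≠ ν' →
    ¬ (fun ξ => likelihood V ξ ν) =ᵐ[μ] fun ξ => likelihood V ξ ν'
  continuousOn : ∀ ξ, ContinuousOn (fun ν => likelihood V ξ ν) σ
  dominated : ∀ ν ∈ σ, ∫⁻ ξ, ⨆ ν' ∈ σ, (logLikelihood V ν' ξ).abs ∂(outcomeMeasure μ V ν) < ∞

/-- `N̂_k`, `k ≥ 1`, is a measurable choice of a maximizer of `l_k` over the spectrum `σ`. -/
def IsMaximumLikelihoodEstimator (V : X → ℝ → ℂ) (σ : Set ℝ) (Nhat : ℕ → (ℕ → X) → ℝ) : Prop :=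
  ∀ k, 1 ≤ k → Measurable (Nhat k) ∧
    ∀ ξ, Nhat k ξ ∈ σ ∧ IsMaxOn (avgLogLikelihood V k ξ) σ (Nhat k ξ)

/-- The relative entropy `S(ν|C) = min_{ν' ∈ C} 𝔼_ν[l(ν|ξ) - l(ν'|ξ)]`. Under the likelihood
assumption, `l` is `μ_ν`-almost surely finite on the spectrum and the infimum over a nonempty
closed subset of the spectrum is a minimum. -/
noncomputable def relativeEntropy (μ : Measure X) (V : X → ℝ → ℂ) (ν : ℝ) (C : Set ℝ) : ℝ :=
  sInf ((fun ν' => ∫ ξ, ((logLikelihood V ν ξ).toReal - (logLikelihood V ν' ξ).toReal)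
    ∂(outcomeMeasure μ V ν)) '' C)

end NonDemolition

/-! All `V_ξ` are functions of the single operator `N`, so they commute, and `tr(Π(B) V_k ρ V_k*)`
is the classical integral of `∏ f(ξ_j|ν)` over `B` against the spectral measure `λ_ρ`. Hence the
outcome law is the mixture `∫ μ_ν^{⊗ℕ} dλ_ρ(ν)` (`outcomeLaw_eq`): nature draws a hidden value `ν`
from `λ_ρ`, then the outcomes are i.i.d. with law `μ_ν`. Almost sure statements need only be proved
under `μ_ν^{⊗ℕ}` for `λ_ρ`-almost every `ν` (`ae_outcomeLaw_of_ae`).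

For fixed `ν`, dominance makes `l(·|ξ)` an integrable random element of the Banach space `C(σ)`. The
strong law there gives `l_k → 𝔼_ν[l]` uniformly on the spectrum
(`ae_tendstoUniformlyOn_log_likelihood`). Gibbs' inequality with identifiability makes `ν` the
unique maximizer of the limit (`expectedLog_lt`), so the estimator converges to `ν`. The limit
therefore recovers the hidden value, whose law is `λ_ρ`.

The posterior mass of `C` is the ratio of `∫_C exp(k l_k) dλ_ρ` to the same integral over the
spectrum. Laplace's principle (`tendsto_log_setIntegral_exp`) gives each integral the rate `max
𝔼_ν[l]` over its domain, and the difference of the two maxima is `S(ν|C)`.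

The reduction to classical probability rests on two operator facts: multiplicativity of the Borel
calculus (`borelCalculus_mul`) and cyclicity of the trace (`trace_mul_mul_adjoint`). -/

namespace NonDemolition

/-! ### Multiplicativity of the Borel functional calculus -/

section BorelCalculus

variable {H : Type*} [NormedAddCommGroup H] [InnerProductSpace ℂ H] [CompleteSpace H]
variable (N : H →L[ℂ] H) (hN : IsSelfAdjoint N)

theorem vectorSpectralMeasure_eq {x : H} {m : Measure ℝ} [IsFiniteMeasure m]
    (h : ∀ f : BoundedContinuousFunction ℝ ℝ,
      ∫ t, f t ∂m = (⟪x, cfcHom hN (f.toContinuousMap.restrict (spectrum ℝ N)) x⟫_ℂ).re) :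
    vectorSpectralMeasure N hN x = m := by
  apply ext_of_forall_integral_eq_of_IsFiniteMeasure
  intro f
  rw [h f]
  exact integral_vectorSpectralMeasure N hN x f.toContinuousMap

/-- Over `ℂ` an operator is determined by its quadratic form. Algebraic identities for `g(N)` are
proved below by checking this characterization. -/
theorem borelCalculus_eq {g : ℝ → ℂ} (hg : Measurable g) {C : ℝ} (hC : ∀ t, ‖g t‖ ≤ C)
    {A : H →L[ℂ] H} (h : ∀ x, ⟪x, A x⟫_ℂ = ∫ t, g t ∂(vectorSpectralMeasure N hN x)) :
    borelCalculus N hN g = A := by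
  apply ContinuousLinearMap.coe_injective
  refine (ext_inner_map _ _).1 fun x => ?_
  rw [← inner_conj_symm, ← inner_conj_symm (A.toLinearMap x)]
  congr 1
  exact (inner_borelCalculus N hN hg hC x).trans (h x).symm

/-- `g(N)` commutes with every unitary that commutes with `N`. -/
theorem commute_borelCalculus_unitary {g : ℝ → ℂ} (hg : Measurable g) {C : ℝ}
    (hC : ∀ t, ‖g t‖ ≤ C) {u : H →L[ℂ] H} (hu : u ∈ unitary (H →L[ℂ] H)) (huN : Commute N u) :
    Commute (borelCalculus N hN g) u := by
  have huu : ContinuousLinearMap.adjoint u * u = 1 := hu.1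
  -- Spectral measures are invariant under `u`, because `u* f(N) u = f(N)` for continuous `f`; then
  -- `u* g(N) u` has the quadratic form of `g(N)`.
  have h1 : ∀ x, vectorSpectralMeasure N hN (u x) = vectorSpectralMeasure N hN x := fun x => by
    refine vectorSpectralMeasure_eq N hN fun f => ?_
    have h2 := integral_vectorSpectralMeasure N hN x f.toContinuousMap
    refine h2.trans ?_
    have hc := hN.commute_cfcHom hN huN (f.toContinuousMap.restrict (spectrum ℝ N))
    rw [← mul_apply_eq_comp, hc.eq, mul_apply_eq_comp,
      ← ContinuousLinearMap.adjoint_inner_right, ← mul_apply_eq_comp, huu]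
    rfl
  have h3 : borelCalculus N hN g =
      ContinuousLinearMap.adjoint u * (borelCalculus N hN g * u) := by
    refine borelCalculus_eq N hN hg hC fun x => ?_
    rw [mul_apply_eq_comp, ContinuousLinearMap.adjoint_inner_right,
      mul_apply_eq_comp, inner_borelCalculus N hN hg hC, h1]
  have h4 : u * ContinuousLinearMap.adjoint u = 1 := hu.2
  have h5 : u * borelCalculus N hN g = borelCalculus N hN g * u := by
    conv_lhs => rw [h3]
    rw [← mul_assoc, h4, one_mul]
  exact h5.symm

/-- `g(N)` commutes with every self-adjoint operator that commutes with `N`. -/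
theorem commute_borelCalculus {g : ℝ → ℂ} (hg : Measurable g) {C : ℝ}
    (hC : ∀ t, ‖g t‖ ≤ C) {T : H →L[ℂ] H} (hT : IsSelfAdjoint T) (hTN : Commute N T) :
    Commute (borelCalculus N hN g) T := by
  wlog hT1 : ‖T‖ ≤ 1 generalizing T
  · have hT0 : 0 < ‖T‖ := lt_trans one_pos (not_le.1 hT1)
    have hT0' : (‖T‖ : ℂ) ≠ 0 := by exact_mod_cast hT0.ne'
    have hs : IsSelfAdjoint ((‖T‖ : ℂ)⁻¹) := by simp [isSelfAdjoint_iff]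
    have h := this (T := (‖T‖ : ℂ)⁻¹ • T) (hs.smul hT) (hTN.smul_right _)
      (by rw [norm_smul, norm_inv, Complex.norm_real, norm_norm, inv_mul_cancel₀ hT0.ne'])
    have h2 := h.smul_right (‖T‖ : ℂ)
    rwa [smul_smul, mul_inv_cancel₀ hT0', one_smul] at h2
  -- A self-adjoint contraction is the average of the unitaries `T ± i √(1 - T²)`, which commute
  -- with `N` whenever `T` does.
  let a : selfAdjoint (H →L[ℂ] H) := ⟨T, hT⟩
  let u := selfAdjoint.unitarySelfAddISMul a hT1
  have hu : (u : H →L[ℂ] H) = T + Complex.I • CFC.sqrt (1 - T ^ 2) := rfl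
  have hus : ((star u : unitary (H →L[ℂ] H)) : H →L[ℂ] H) =
      T - Complex.I • CFC.sqrt (1 - T ^ 2) := selfAdjoint.star_coe_unitarySelfAddISMul a hT1
  have hs : Commute N (CFC.sqrt (1 - T ^ 2)) := by
    rw [CFC.sqrt_eq_cfc]
    refine (Commute.cfc_nnreal ?_ _).symm
    exact ((Commute.one_right _).sub_right (hTN.pow_right 2)).symm
  have h1 := commute_borelCalculus_unitary N hN hg hC u.2 (by
    rw [hu]; exact hTN.add_right (hs.smul_right _))
  have h2 := commute_borelCalculus_unitary N hN hg hC (star u).2 (by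
    rw [hus]; exact hTN.sub_right (hs.smul_right _))
  have h3 := (h1.add_right h2).smul_right (1 / 2 : ℂ)
  have h4 : (1 / 2 : ℂ) • ((u : H →L[ℂ] H) + ((star u : unitary (H →L[ℂ] H)) : H →L[ℂ] H)) = T := by
    rw [hu, hus, add_add_sub_cancel, ← two_smul ℂ, smul_smul]
    norm_num
  rwa [h4] at h3

theorem borelCalculus_add {g h : ℝ → ℂ} (hg : Measurable g) {C : ℝ} (hC : ∀ t, ‖g t‖ ≤ C)
    (hh : Measurable h) {D : ℝ} (hD : ∀ t, ‖h t‖ ≤ D) :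
    borelCalculus N hN (fun t => g t + h t) = borelCalculus N hN g + borelCalculus N hN h := by
  refine borelCalculus_eq N hN (g := fun t => g t + h t) (hg.add hh)
    (fun t => (norm_add_le _ _).trans (add_le_add (hC t) (hD t))) fun x => ?_
  rw [integral_add (integrable_vectorSpectralMeasure N hN x hg hC)
    (integrable_vectorSpectralMeasure N hN x hh hD), add_apply, inner_add_right,
    inner_borelCalculus N hN hg hC, inner_borelCalculus N hN hh hD]

theorem borelCalculus_smul (c : ℂ) {g : ℝ → ℂ} (hg : Measurable g) {C : ℝ}
    (hC : ∀ t, ‖g t‖ ≤ C) :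
    borelCalculus N hN (fun t => c * g t) = c • borelCalculus N hN g := by
  refine borelCalculus_eq N hN (hg.const_mul c) (C := ‖c‖ * C)
    (fun t => by rw [norm_mul]; gcongr; exact hC t) fun x => ?_
  rw [integral_const_mul, smul_apply, inner_smul_right,
    inner_borelCalculus N hN hg hC]

theorem borelCalculus_one : borelCalculus N hN (fun _ => 1) = 1 := by
  refine borelCalculus_eq N hN measurable_const (C := 1) (by simp) fun x => ?_
  have h := measureReal_vectorSpectralMeasure_univ N hN x
  simp [h, inner_self_eq_norm_sq_to_K]

theorem adjoint_borelCalculus {g : ℝ → ℂ} (hg : Measurable g) {C : ℝ} (hC : ∀ t, ‖g t‖ ≤ C) :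
    ContinuousLinearMap.adjoint (borelCalculus N hN g) =
      borelCalculus N hN (fun t => starRingEnd ℂ (g t)) := by
  refine (borelCalculus_eq N hN (Complex.continuous_conj.measurable.comp hg) (C := C)
    (fun t => by simpa using hC t) fun x => ?_).symm
  rw [ContinuousLinearMap.adjoint_inner_right, ← inner_conj_symm,
    inner_borelCalculus N hN hg hC]
  exact integral_conj.symm

theorem commute_self_borelCalculus {g : ℝ → ℂ} (hg : Measurable g) {C : ℝ}
    (hC : ∀ t, ‖g t‖ ≤ C) : Commute N (borelCalculus N hN g) :=
  (commute_borelCalculus N hN hg hC hN (Commute.refl N)).symm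

theorem borelCalculus_nonneg {h : ℝ → ℝ} (hh : Measurable h) {C : ℝ} (hC : ∀ t, |h t| ≤ C)
    (h0 : ∀ t, 0 ≤ h t) : 0 ≤ borelCalculus N hN (fun t => (h t : ℂ)) := by
  rw [ContinuousLinearMap.nonneg_iff_isPositive, ContinuousLinearMap.isPositive_iff_complex]
  intro x
  have h1 := inner_borelCalculus N hN (g := fun t => (h t : ℂ)) (Complex.measurable_ofReal.comp hh)
    (C := C) (fun t => by simpa using hC t) x
  rw [integral_complex_ofReal] at h1
  rw [← inner_conj_symm, h1]
  simpa using integral_nonneg (fun t => h0 t)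

/-- If `A ≥ 0` commutes with `N` and acts on spectral measures as multiplication by `h`, then
`(h g)(N) = A g(N)` for all bounded Borel functions `g`. -/
theorem borelCalculus_mul_eq {h : ℝ → ℝ} (hh : Measurable h) {C : ℝ} (hC : ∀ t, |h t| ≤ C)
    (h0 : ∀ t, 0 ≤ h t) {A : H →L[ℂ] H} (hA0 : 0 ≤ A) (hNA : Commute N A)
    (hA : ∀ (f : BoundedContinuousFunction ℝ ℝ) (x : H),
      (⟪x, cfcHom hN (f.toContinuousMap.restrict (spectrum ℝ N)) (A x)⟫_ℂ).re =
        ∫ t, h t * f t ∂(vectorSpectralMeasure N hN x))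
    {g : ℝ → ℂ} (hg : Measurable g) {D : ℝ} (hD : ∀ t, ‖g t‖ ≤ D) :
    borelCalculus N hN (fun t => (h t : ℂ) * g t) = A * borelCalculus N hN g := by
  have hhm : Measurable fun t => (h t : ℂ) := Complex.measurable_ofReal.comp hh
  have hCb : ∀ t, ‖(h t : ℂ)‖ ≤ C := fun t => by simpa using hC t
  set S := CFC.sqrt A with hS
  have hSS : S * S = A := CFC.sqrt_mul_sqrt_self A hA0
  have hSp : S.IsPositive := (ContinuousLinearMap.nonneg_iff_isPositive _).1 (CFC.sqrt_nonneg A)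
  have hSN : Commute N S := by
    rw [hS, CFC.sqrt_eq_cfc]
    exact (Commute.cfc_nnreal hNA.symm _).symm
  have hSs : ∀ x y, ⟪S x, y⟫_ℂ = ⟪x, S y⟫_ℂ := hSp.isSymmetric
  -- Since `⟨Sx, f(N) S x⟩ = ⟨x, f(N) A x⟩`, the spectral measure at `S x` has density `h` with
  -- respect to the one at `x`. The claim follows from `⟨x, A g(N) x⟩ = ⟨Sx, g(N) S x⟩`, as `S` also
  -- commutes with `g(N)`.
  have hmeas : ∀ x, vectorSpectralMeasure N hN (S x) =
      (vectorSpectralMeasure N hN x).withDensity fun t => ENNReal.ofReal (h t) := fun x => by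
    have hfin : IsFiniteMeasure
        ((vectorSpectralMeasure N hN x).withDensity fun t => ENNReal.ofReal (h t)) :=
      isFiniteMeasure_withDensity_ofReal
        (Integrable.of_bound hh.aestronglyMeasurable C (Eventually.of_forall hC)).2
    refine vectorSpectralMeasure_eq N hN fun f => ?_
    have hFS := hN.commute_cfcHom hN hSN (f.toContinuousMap.restrict (spectrum ℝ N))
    rw [hSs, ← mul_apply_eq_comp S, ← hFS.eq, mul_apply_eq_comp, ← mul_apply_eq_comp S,
      hSS, hA f x, integral_withDensity_eq_integral_toReal_smul (by fun_prop) (by simp)]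
    refine integral_congr_ae (Eventually.of_forall fun t => ?_)
    simp [ENNReal.toReal_ofReal (h0 t)]
  refine borelCalculus_eq N hN (g := fun t => (h t : ℂ) * g t) (hhm.mul hg) (C := C * D)
    (fun t => ?_) fun x => ?_
  · rw [norm_mul]
    exact mul_le_mul (hCb t) (hD t) (norm_nonneg _) ((norm_nonneg _).trans (hCb t))
  have hSg : Commute (borelCalculus N hN g) S :=
    commute_borelCalculus N hN hg hD hSp.isSelfAdjoint hSN
  rw [← hSS, mul_assoc, ← hSg.eq, mul_apply_eq_comp, ← hSs,
    mul_apply_eq_comp, inner_borelCalculus N hN hg hD, hmeas,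
    integral_withDensity_eq_integral_toReal_smul (by fun_prop) (by simp)]
  refine integral_congr_ae (Eventually.of_forall fun t => ?_)
  simp [ENNReal.toReal_ofReal (h0 t)]

/-- First half of a bootstrap: the hypothesis on `A = f(N)` in `borelCalculus_mul_eq` is
multiplicativity of the continuous calculus. The conclusion, with a Borel second factor, in turn
supplies that hypothesis for `A = h(N)` with `h` Borel. -/
theorem borelCalculus_mul_of_continuous {f : BoundedContinuousFunction ℝ ℝ} (hf : ∀ t, 0 ≤ f t)
    {g : ℝ → ℂ} (hg : Measurable g) {D : ℝ} (hD : ∀ t, ‖g t‖ ≤ D) :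
    borelCalculus N hN (fun t => (f t : ℂ) * g t) =
      cfcHom hN (f.toContinuousMap.restrict (spectrum ℝ N)) * borelCalculus N hN g := by
  refine borelCalculus_mul_eq N hN f.continuous.measurable (fun t => f.norm_coe_le_norm t) hf
    ((cfcHom_nonneg_iff hN).2 fun t => hf t) (hN.commute_cfcHom hN (Commute.refl N) _).symm
    (fun f' x => ?_) hg hD
  have h1 := integral_vectorSpectralMeasure N hN x (f * f').toContinuousMap
  have h2 : (f * f').toContinuousMap.restrict (spectrum ℝ N) =
      f'.toContinuousMap.restrict (spectrum ℝ N) * f.toContinuousMap.restrict (spectrum ℝ N) := by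
    ext t
    exact mul_comm _ _
  rw [h2, map_mul] at h1
  exact h1.symm

/-- Multiplicativity of the Borel functional calculus when one factor is nonnegative. -/
theorem borelCalculus_mul_of_nonneg {h : ℝ → ℝ} (hh : Measurable h) {C : ℝ}
    (hC : ∀ t, |h t| ≤ C) (h0 : ∀ t, 0 ≤ h t) {g : ℝ → ℂ} (hg : Measurable g) {D : ℝ}
    (hD : ∀ t, ‖g t‖ ≤ D) :
    borelCalculus N hN (fun t => (h t : ℂ) * g t) =
      borelCalculus N hN (fun t => (h t : ℂ)) * borelCalculus N hN g := by
  have hhm : Measurable fun t => (h t : ℂ) := Complex.measurable_ofReal.comp hh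
  have hCb : ∀ t, ‖(h t : ℂ)‖ ≤ C := fun t => by simpa using hC t
  refine borelCalculus_mul_eq N hN hh hC h0 (borelCalculus_nonneg N hN hh hC h0)
    (commute_self_borelCalculus N hN hhm hCb) (fun f x => ?_) hg hD
  -- Adding the constant `‖f‖` makes `f` nonnegative, as the continuous case requires; its
  -- contribution `‖f‖ ⟨x, h(N) x⟩` is cancelled at the end.
  have hc0 : ∀ t, 0 ≤ (f + BoundedContinuousFunction.const ℝ ‖f‖) t := fun t => by
    have := neg_le_of_abs_le (f.norm_coe_le_norm t)
    simpa using by linarith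
  have h1 := borelCalculus_mul_of_continuous N hN hc0 hhm hCb
  have h2 : (f + BoundedContinuousFunction.const ℝ ‖f‖).toContinuousMap.restrict (spectrum ℝ N) =
      f.toContinuousMap.restrict (spectrum ℝ N) + algebraMap ℝ C(spectrum ℝ N, ℝ) ‖f‖ := rfl
  rw [h2, map_add, AlgHomClass.commutes] at h1
  have h3 := congrArg (fun T : H →L[ℂ] H => ⟪x, T x⟫_ℂ) h1
  have hb : ∀ t, ‖((f + BoundedContinuousFunction.const ℝ ‖f‖) t : ℂ) * (h t : ℂ)‖ ≤
      ‖f + BoundedContinuousFunction.const ℝ ‖f‖‖ * C := fun t => by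
    rw [norm_mul]
    refine mul_le_mul ?_ (hCb t) (norm_nonneg _) (norm_nonneg _)
    rw [Complex.norm_real]
    exact (f + BoundedContinuousFunction.const ℝ ‖f‖).norm_coe_le_norm t
  have hm : Measurable fun t => ((f + BoundedContinuousFunction.const ℝ ‖f‖) t : ℂ) * (h t : ℂ) :=
    (Complex.measurable_ofReal.comp
      (f + BoundedContinuousFunction.const ℝ ‖f‖).continuous.measurable).mul hhm
  have hi : Integrable h (vectorSpectralMeasure N hN x) :=
    Integrable.of_bound hh.aestronglyMeasurable C (Eventually.of_forall hC)
  have hfi : Integrable (fun t => h t * f t) (vectorSpectralMeasure N hN x) :=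
    hi.mul_bdd (c := ‖f‖) f.continuous.aestronglyMeasurable (Eventually.of_forall f.norm_coe_le_norm)
  have h4 : ∫ t, ((f + BoundedContinuousFunction.const ℝ ‖f‖) t : ℂ) * (h t : ℂ)
      ∂(vectorSpectralMeasure N hN x) = ((∫ t, h t * f t ∂(vectorSpectralMeasure N hN x) +
        ‖f‖ * ∫ t, h t ∂(vectorSpectralMeasure N hN x) : ℝ) : ℂ) := by
    rw [← integral_const_mul, ← integral_add hfi (hi.const_mul _), ← integral_complex_ofReal]
    refine integral_congr_ae (Eventually.of_forall fun t => ?_)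
    simp
    ring
  rw [inner_borelCalculus N hN hm hb, h4, add_mul] at h3
  have h5 : algebraMap ℝ (H →L[ℂ] H) ‖f‖ = (‖f‖ : ℂ) • (1 : H →L[ℂ] H) := by
    rw [Algebra.algebraMap_eq_smul_one]
    rfl
  rw [h5, smul_mul_assoc, one_mul, add_apply, inner_add_right, smul_apply, inner_smul_right,
    inner_borelCalculus N hN hhm hCb, integral_complex_ofReal, mul_apply_eq_comp] at h3
  have h6 := congrArg Complex.re h3
  rw [Complex.add_re, ← Complex.ofReal_mul, Complex.ofReal_re, Complex.ofReal_re] at h6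
  linarith

/-- Multiplicativity of the bounded Borel functional calculus. -/
theorem borelCalculus_mul {h g : ℝ → ℂ} (hh : Measurable h) {C : ℝ} (hC : ∀ t, ‖h t‖ ≤ C)
    (hg : Measurable g) {D : ℝ} (hD : ∀ t, ‖g t‖ ≤ D) :
    borelCalculus N hN (fun t => h t * g t) = borelCalculus N hN h * borelCalculus N hN g := by
  have hC0 : 0 ≤ C := (norm_nonneg _).trans (hC 0)
  have hre : ∀ t, |(h t).re + C| ≤ 2 * C := fun t => by
    have := Complex.abs_re_le_norm (h t)
    have := hC t
    rw [abs_le] at *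
    constructor <;> linarith
  have him : ∀ t, |(h t).im + C| ≤ 2 * C := fun t => by
    have := Complex.abs_im_le_norm (h t)
    have := hC t
    rw [abs_le] at *
    constructor <;> linarith
  have hre0 : ∀ t, 0 ≤ (h t).re + C := fun t => by
    have := neg_le_of_abs_le (Complex.abs_re_le_norm (h t))
    have := hC t
    linarith
  have him0 : ∀ t, 0 ≤ (h t).im + C := fun t => by
    have := neg_le_of_abs_le (Complex.abs_im_le_norm (h t))
    have := hC t
    linarith
  have hrem : Measurable fun t => (h t).re + C := (Complex.measurable_re.comp hh).add_const _
  have himm : Measurable fun t => (h t).im + C := (Complex.measurable_im.comp hh).add_const _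
  -- With `h = (Re h + C) + i (Im h + C) - (1 + i) C`, the nonnegative case applies to both shifted
  -- parts. The operator in front of `g(N)` does not depend on `g`, and taking `g = 1` identifies it
  -- as `h(N)`.
  have key : ∀ {g : ℝ → ℂ} (_ : Measurable g) {D : ℝ} (_ : ∀ t, ‖g t‖ ≤ D),
      borelCalculus N hN (fun t => h t * g t) =
        (borelCalculus N hN (fun t => (((h t).re + C : ℝ) : ℂ)) +
          Complex.I • borelCalculus N hN (fun t => (((h t).im + C : ℝ) : ℂ)) +
          (-(1 + Complex.I) * C) • 1) * borelCalculus N hN g := by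
    intro g hg D hD
    have hb : ∀ {q : ℝ → ℝ} (_ : ∀ t, |q t| ≤ 2 * C) t, ‖(q t : ℂ) * g t‖ ≤ 2 * C * D :=
      fun hq t => by
        rw [norm_mul]
        exact mul_le_mul (by simpa using hq t) (hD t) (norm_nonneg _) (by positivity)
    have hm : ∀ {q : ℝ → ℝ} (_ : Measurable q), Measurable fun t => (q t : ℂ) * g t :=
      fun hq => (Complex.measurable_ofReal.comp hq).mul hg
    have e : (fun t => h t * g t) = fun t => ((((h t).re + C : ℝ) : ℂ) * g t +
        Complex.I * ((((h t).im + C : ℝ) : ℂ) * g t)) + (-(1 + Complex.I) * C) * g t := by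
      funext t
      conv_lhs => rw [← Complex.re_add_im (h t)]
      push_cast
      ring
    have hb1 : ∀ t, ‖Complex.I * ((((h t).im + C : ℝ) : ℂ) * g t)‖ ≤ 2 * C * D := fun t => by
      rw [norm_mul, Complex.norm_I, one_mul]
      exact hb him t
    rw [e, borelCalculus_add N hN (g := fun t => (((h t).re + C : ℝ) : ℂ) * g t +
        Complex.I * ((((h t).im + C : ℝ) : ℂ) * g t)) ((hm hrem).add ((hm himm).const_mul _))
      (fun t => (norm_add_le _ _).trans (add_le_add (hb hre t) (hb1 t)))
      (hg.const_mul _) (D := ‖-(1 + Complex.I) * C‖ * D)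
      (fun t => by rw [norm_mul]; gcongr; exact hD t),
      borelCalculus_add N hN (hm hrem) (hb hre) ((hm himm).const_mul _) hb1,
      borelCalculus_smul N hN _ (hm himm) (hb him), borelCalculus_smul N hN _ hg hD,
      borelCalculus_mul_of_nonneg N hN hrem hre hre0 hg hD,
      borelCalculus_mul_of_nonneg N hN himm him him0 hg hD, add_mul, add_mul, smul_mul_assoc,
      smul_mul_assoc, one_mul]
  have h1 := key (g := fun _ => 1) measurable_const (D := 1) (by simp)
  rw [borelCalculus_one, mul_one] at h1
  simp only [mul_one] at h1
  rw [key hg hD, ← h1]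

end BorelCalculus

/-! ### Cyclicity of the trace -/

section Trace

variable {H : Type*} [NormedAddCommGroup H] [InnerProductSpace ℂ H] [CompleteSpace H]

/-- If `∑ⱼ ‖T eⱼ‖²` is finite for a symmetric `T`, then
`∑ᵢ ⟨eᵢ, D T² A* eᵢ⟩ = ∑ⱼ ⟨A T eⱼ, D T eⱼ⟩`. -/
theorem tsum_inner_mul_sq_mul_adjoint {ι : Type*} (b : HilbertBasis ι ℂ H) (T A D : H →L[ℂ] H)
    (hTs : ∀ x y, ⟪T x, y⟫_ℂ = ⟪x, T y⟫_ℂ) (hn : Summable fun j => ‖T (b j)‖ ^ 2) :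
    ∑' i, ⟪b i, D (T (T (ContinuousLinearMap.adjoint A (b i))))⟫_ℂ =
      ∑' j, ⟪A (T (b j)), D (T (b j))⟫_ℂ := by
  have hsq : ∀ v : H, HasSum (fun i => ‖⟪b i, v⟫_ℂ‖ ^ 2) (‖v‖ ^ 2) := fun v => by
    have h1 := Complex.hasSum_re (b.hasSum_inner_mul_inner v v)
    rw [inner_self_eq_norm_sq_to_K] at h1
    convert h1 using 2 with i
    · rw [← inner_conj_symm v (b i), ← Complex.normSq_eq_conj_mul_self, Complex.ofReal_re,
        Complex.normSq_eq_norm_sq]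
    · norm_cast
  have hdom : ∀ S : H →L[ℂ] H, Summable
      (fun p : ι × ι => ‖⟪b p.2, S (T (b p.1))⟫_ℂ‖ ^ 2) := fun S => by
    refine (summable_prod_of_nonneg (fun p => sq_nonneg _)).2
      ⟨fun j => (hsq (S (T (b j)))).summable, ?_⟩
    have h0 : ∀ j, ∑' i, ‖⟪b i, S (T (b j))⟫_ℂ‖ ^ 2 = ‖S (T (b j))‖ ^ 2 :=
      fun j => (hsq (S (T (b j)))).tsum_eq
    simp only [h0]
    refine Summable.of_nonneg_of_le (fun j => sq_nonneg _) (fun j => ?_)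
      (hn.mul_left (‖S‖ ^ 2))
    rw [← mul_pow]
    gcongr
    exact S.le_opNorm _
  -- Absolute summability of the double series, from `|ab| ≤ (|a|² + |b|²)/2` and the
  -- Hilbert–Schmidt bounds `hdom`, lets the two orders of summation be exchanged.
  have hFs : Summable
      (fun p : ι × ι => ⟪A (T (b p.1)), b p.2⟫_ℂ * ⟪b p.2, D (T (b p.1))⟫_ℂ) := by
    refine Summable.of_norm_bounded (((hdom A).add (hdom D)).mul_left (1 / 2)) fun p => ?_
    rw [norm_mul, norm_inner_symm (A (T (b p.1))) (b p.2)]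
    nlinarith [sq_nonneg (‖⟪b p.2, A (T (b p.1))⟫_ℂ‖ - ‖⟪b p.2, D (T (b p.1))⟫_ℂ‖)]
  have h1 : ∀ j, HasSum (fun i => ⟪A (T (b j)), b i⟫_ℂ * ⟪b i, D (T (b j))⟫_ℂ)
      ⟪A (T (b j)), D (T (b j))⟫_ℂ := fun j => b.hasSum_inner_mul_inner _ _
  have h2 : ∀ i, HasSum (fun j => ⟪A (T (b j)), b i⟫_ℂ * ⟪b i, D (T (b j))⟫_ℂ)
      ⟪b i, D (T (T (ContinuousLinearMap.adjoint A (b i))))⟫_ℂ := fun i => by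
    have h3 := b.hasSum_inner_mul_inner (T (ContinuousLinearMap.adjoint D (b i)))
      (T (ContinuousLinearMap.adjoint A (b i)))
    rw [hTs, ContinuousLinearMap.adjoint_inner_left] at h3
    have h4 : (fun j => ⟪A (T (b j)), b i⟫_ℂ * ⟪b i, D (T (b j))⟫_ℂ) = fun j =>
        ⟪T (ContinuousLinearMap.adjoint D (b i)), b j⟫_ℂ *
          ⟪b j, T (ContinuousLinearMap.adjoint A (b i))⟫_ℂ := by
      funext j
      rw [hTs (ContinuousLinearMap.adjoint D (b i)), ContinuousLinearMap.adjoint_inner_left,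
        ← hTs (b j), ContinuousLinearMap.adjoint_inner_right, mul_comm]
    rw [h4]
    exact h3
  have h5 := hFs.hasSum.prod_fiberwise h1
  have h6 := ((Equiv.prodComm ι ι).hasSum_iff.2 hFs.hasSum).prod_fiberwise h2
  rw [h6.tsum_eq, h5.tsum_eq]

/-- Cyclicity of the trace: `tr(B A ρ A*) = tr(A* B A ρ)` for a density matrix `ρ`. -/
theorem trace_mul_mul_adjoint {ρ : H →L[ℂ] H} (hρ : IsDensityMatrix ρ) (A B : H →L[ℂ] H) :
    trace (B * (A * ρ * ContinuousLinearMap.adjoint A)) =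
      trace (ContinuousLinearMap.adjoint A * B * A * ρ) := by
  have hρ0 : 0 ≤ ρ := (ContinuousLinearMap.nonneg_iff_isPositive _).2 hρ.isPositive
  have hTT : ∀ x, ρ x = CFC.sqrt ρ (CFC.sqrt ρ x) := fun x => by
    conv_lhs => rw [← CFC.sqrt_mul_sqrt_self ρ hρ0]
    rfl
  have hTs : ∀ x y, ⟪CFC.sqrt ρ x, y⟫_ℂ = ⟪x, CFC.sqrt ρ y⟫_ℂ :=
    ((ContinuousLinearMap.nonneg_iff_isPositive _).1 (CFC.sqrt_nonneg ρ)).isSymmetric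
  obtain ⟨hn, htr⟩ := hasSum_trace_mul hρ
  rw [← (htr _).tsum_eq, trace]
  have h := tsum_inner_mul_sq_mul_adjoint (onBasis H) (CFC.sqrt ρ) A (B * A) hTs hn.summable
  simp only [← hTT] at h
  refine Eq.trans h ?_
  refine tsum_congr fun j => ?_
  simp only [mul_apply_eq_comp, ContinuousLinearMap.adjoint_inner_right]

end Trace

/-! ### Traces of posterior states as integrals against the spectral measure -/

section Posterior

variable {H : Type*} [NormedAddCommGroup H] [InnerProductSpace ℂ H] [CompleteSpace H]
variable {X : Type*} [MeasurableSpace X]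
variable {N : H →L[ℂ] H} (hN : IsSelfAdjoint N) {ρ : H →L[ℂ] H}

theorem isSpectralMeasure_stateSpectralMeasure (hρ : IsDensityMatrix ρ) :
    IsSpectralMeasure N hN ρ (stateSpectralMeasure N hN ρ) := by
  have h := exists_isSpectralMeasure N hN hρ
  rw [stateSpectralMeasure, dif_pos h]
  exact h.choose_spec

theorem trace_spectralProjection_mul (hρ : IsDensityMatrix ρ) {B : Set ℝ} (hB : MeasurableSet B) :
    trace (spectralProjection N hN B * ρ) = ((stateSpectralMeasure N hN ρ).real B : ℂ) := by
  rw [spectralProjection, (isSpectralMeasure_stateSpectralMeasure hN hρ).2 _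
    (measurable_const.indicator hB) ⟨1, fun t => by
      by_cases h : t ∈ B <;> simp [h]⟩, integral_indicator hB]
  simp

theorem isProbabilityMeasure_stateSpectralMeasure (hρ : IsDensityMatrix ρ) :
    IsProbabilityMeasure (stateSpectralMeasure N hN ρ) := by
  have := (isSpectralMeasure_stateSpectralMeasure hN hρ).1
  have h := (isSpectralMeasure_stateSpectralMeasure hN hρ).2 (fun _ => 1) measurable_const
    ⟨1, by simp⟩
  rw [borelCalculus_one, one_mul, trace, hρ.hasSum_one.tsum_eq] at h
  have h2 : (stateSpectralMeasure N hN ρ).real Set.univ = 1 := by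
    simp only [integral_const, Complex.real_smul, mul_one] at h
    exact_mod_cast h.symm
  exact ⟨by rw [← ofReal_measureReal, h2, ENNReal.ofReal_one]⟩

theorem measurableSet_spectrum (N : H →L[ℂ] H) : MeasurableSet (spectrum ℝ N) :=
  (spectrum.isCompact N).measurableSet

theorem ae_mem_spectrum (hρ : IsDensityMatrix ρ) :
    ∀ᵐ ν ∂(stateSpectralMeasure N hN ρ), ν ∈ spectrum ℝ N := by
  have := (isSpectralMeasure_stateSpectralMeasure hN hρ).1
  have hc : MeasurableSet (spectrum ℝ N)ᶜ := (measurableSet_spectrum N).compl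
  have h := trace_spectralProjection_mul hN hρ hc
  -- Each vector spectral measure is a pushforward from the spectrum, so the spectral projection of
  -- the complement has zero quadratic form.
  have hv : ∀ x, vectorSpectralMeasure N hN x (spectrum ℝ N)ᶜ = 0 := fun x => by
    rw [vectorSpectralMeasure, Measure.map_apply measurable_subtype_coe hc]
    have he : (Subtype.val : spectrum ℝ N → ℝ) ⁻¹' (spectrum ℝ N)ᶜ = ∅ := by
      ext t
      simp
    rw [he, measure_empty]
  have h0 : spectralProjection N hN (spectrum ℝ N)ᶜ = 0 := by
    refine borelCalculus_eq N hN (measurable_const.indicator hc) (C := 1) (fun t => ?_) fun x => ?_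
    · by_cases h : t ∈ (spectrum ℝ N)ᶜ <;> simp [h]
    · rw [integral_indicator hc, Measure.restrict_eq_zero.2 (hv x)]
      simp
  rw [h0, zero_mul, trace] at h
  simp only [zero_apply, inner_zero_right, tsum_zero] at h
  have h1 : (stateSpectralMeasure N hN ρ).real (spectrum ℝ N)ᶜ = 0 := by exact_mod_cast h.symm
  exact (measureReal_eq_zero_iff).1 h1

theorem IsJumpFamily.measurable_apply {μ : Measure X} {V : X → ℝ → ℂ} (hV : IsJumpFamily μ V)
    (ξ : X) : Measurable (V ξ) :=
  hV.measurable.comp measurable_prodMk_left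

theorem IsJumpFamily.exists_prod_bound {μ : Measure X} {V : X → ℝ → ℂ} (hV : IsJumpFamily μ V)
    {k : ℕ} (ξ : Fin k → X) : ∃ C : ℝ, ∀ ν, ‖∏ i, V (ξ i) ν‖ ≤ C := by
  choose C hC using hV.bounded
  refine ⟨∏ i, C (ξ i), fun ν => ?_⟩
  rw [norm_prod]
  exact Finset.prod_le_prod (fun _ _ => norm_nonneg _) fun i _ => hC _ _

theorem jumpProduct_eq {μ : Measure X} {V : X → ℝ → ℂ} (hV : IsJumpFamily μ V) {k : ℕ}
    (ξ : Fin k → X) :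
    jumpProduct N hN V ξ = borelCalculus N hN (fun ν => ∏ i, V (ξ i) ν) := by
  induction k with
  | zero => simp [jumpProduct, borelCalculus_one]
  | succ k ih =>
    obtain ⟨C, hC⟩ := hV.exists_prod_bound fun i => ξ (Fin.castSucc i)
    obtain ⟨D, hD⟩ := hV.bounded (ξ (Fin.last k))
    have h := ih fun i => ξ (Fin.castSucc i)
    simp only [jumpProduct] at h ⊢
    rw [List.ofFn_succ', List.concat_eq_append, List.reverse_append, List.prod_append, h]
    simp only [Fin.prod_univ_castSucc, mul_comm _ (V (ξ (Fin.last k)) _)]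
    rw [borelCalculus_mul N hN (hV.measurable_apply _) hD
      (Finset.measurable_fun_prod _ fun i _ => hV.measurable_apply _) hC]
    simp

omit [MeasurableSpace X] in
theorem likelihood_nonneg (V : X → ℝ → ℂ) (ξ : X) (ν : ℝ) : 0 ≤ likelihood V ξ ν := sq_nonneg _

/-- This is where the quantum problem becomes classical: cyclicity turns the trace into that of
`V_k* Π(B) V_k ρ`, and multiplicativity merges the operators into one function of `N`, namely `1_B ∏
|V_{ξ_j}|²`. -/
theorem trace_spectralProjection_mul_unnormalizedPosterior {μ : Measure X} {V : X → ℝ → ℂ}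
    (hV : IsJumpFamily μ V) (hρ : IsDensityMatrix ρ) {k : ℕ} (ξ : Fin k → X) {B : Set ℝ}
    (hB : MeasurableSet B) :
    trace (spectralProjection N hN B * unnormalizedPosterior N hN V ρ ξ) =
      ((∫ ν in B, ∏ i, likelihood V (ξ i) ν ∂(stateSpectralMeasure N hN ρ) : ℝ) : ℂ) := by
  obtain ⟨C, hC⟩ := hV.exists_prod_bound ξ
  have hC0 : 0 ≤ C := (norm_nonneg _).trans (hC 0)
  have hm : Measurable fun ν => ∏ i, V (ξ i) ν :=
    Finset.measurable_fun_prod _ fun i _ => hV.measurable_apply _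
  have hmc : Measurable fun ν => starRingEnd ℂ (∏ i, V (ξ i) ν) :=
    Complex.continuous_conj.measurable.comp hm
  have hCc : ∀ ν, ‖starRingEnd ℂ (∏ i, V (ξ i) ν)‖ ≤ C := fun ν => by
    rw [RCLike.norm_conj]; exact hC ν
  have hi : Measurable (B.indicator fun _ => (1 : ℂ)) := measurable_const.indicator hB
  have hib : ∀ t, ‖B.indicator (fun _ => (1 : ℂ)) t‖ ≤ 1 := fun t => by
    by_cases h : t ∈ B <;> simp [h]
  have hib' : ∀ ν, ‖starRingEnd ℂ (∏ i, V (ξ i) ν) * B.indicator (fun _ => (1 : ℂ)) ν‖ ≤ C * 1 :=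
    fun ν => by
      rw [norm_mul]
      exact mul_le_mul (hCc ν) (hib ν) (norm_nonneg _) hC0
  rw [unnormalizedPosterior, trace_mul_mul_adjoint hρ, jumpProduct_eq hN hV,
    adjoint_borelCalculus N hN hm hC, spectralProjection,
    ← borelCalculus_mul N hN hmc hCc hi hib,
    ← borelCalculus_mul N hN (h := fun ν => starRingEnd ℂ (∏ i, V (ξ i) ν) *
      B.indicator (fun _ => (1 : ℂ)) ν) (hmc.mul hi) hib' hm hC,
    (isSpectralMeasure_stateSpectralMeasure hN hρ).2
      (fun ν => starRingEnd ℂ (∏ i, V (ξ i) ν) * B.indicator (fun _ => (1 : ℂ)) ν *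
        ∏ i, V (ξ i) ν) ((hmc.mul hi).mul hm)
      ⟨C * 1 * C, fun ν => by
        rw [norm_mul]
        exact mul_le_mul (hib' ν) (hC ν) (norm_nonneg _) (by positivity)⟩,
    ← integral_indicator hB, ← integral_complex_ofReal]
  refine integral_congr_ae (Eventually.of_forall fun ν => ?_)
  by_cases h : ν ∈ B
  · simp only [Set.indicator_of_mem h, mul_one, likelihood]
    rw [← Complex.normSq_eq_conj_mul_self, Complex.normSq_eq_norm_sq, norm_prod, Finset.prod_pow]
  · simp [h]

theorem spectralProjection_univ : spectralProjection N hN Set.univ = 1 := by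
  rw [spectralProjection]
  simp [borelCalculus_one]

theorem trace_unnormalizedPosterior {μ : Measure X} {V : X → ℝ → ℂ}
    (hV : IsJumpFamily μ V) (hρ : IsDensityMatrix ρ) {k : ℕ} (ξ : Fin k → X) :
    trace (unnormalizedPosterior N hN V ρ ξ) =
      ((∫ ν, ∏ i, likelihood V (ξ i) ν ∂(stateSpectralMeasure N hN ρ) : ℝ) : ℂ) := by
  have h := trace_spectralProjection_mul_unnormalizedPosterior hN hV hρ ξ MeasurableSet.univ
  rwa [spectralProjection_univ, one_mul, Measure.restrict_univ] at h

theorem trace_spectralProjection_mul_posterior {μ : Measure X} {V : X → ℝ → ℂ}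
    (hV : IsJumpFamily μ V) (hρ : IsDensityMatrix ρ) (k : ℕ) (ξ : ℕ → X) {B : Set ℝ}
    (hB : MeasurableSet B) :
    (trace (spectralProjection N hN B * posterior N hN V ρ k ξ)).re =
      (∫ ν in B, ∏ j ∈ Finset.range k, likelihood V (ξ j) ν ∂(stateSpectralMeasure N hN ρ)) /
        ∫ ν, ∏ j ∈ Finset.range k, likelihood V (ξ j) ν ∂(stateSpectralMeasure N hN ρ) := by
  have h : ∀ (c : ℂ) (A : H →L[ℂ] H), trace (c • A) = c * trace A := fun c A => by
    simp [trace, tsum_mul_left]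
  rw [posterior, mul_smul_comm, h,
    trace_spectralProjection_mul_unnormalizedPosterior hN hV hρ _ hB,
    trace_unnormalizedPosterior hN hV hρ, ← Complex.ofReal_inv, ← Complex.ofReal_mul,
    Complex.ofReal_re, inv_mul_eq_div]
  simp only [Finset.prod_range]

end Posterior

/-! ### Product densities and cylinder sets -/

section ProductMeasure

variable {X : Type*} [MeasurableSpace X]

theorem lintegral_fin_prod (μ : Measure X) [SigmaFinite μ] {k : ℕ} {f : Fin k → X → ℝ≥0∞}
    (hf : ∀ i, Measurable (f i)) :
    ∫⁻ x, ∏ i, f i (x i) ∂(Measure.pi fun _ : Fin k => μ) = ∏ i, ∫⁻ y, f i y ∂μ := by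
  induction k with
  | zero => simp
  | succ k ih =>
    have hm : Measurable fun x : Fin k → X => ∏ i, f (Fin.succ i) (x i) :=
      Finset.measurable_fun_prod _ fun i _ => (hf _).comp (measurable_pi_apply i)
    rw [Fin.prod_univ_succ, ← ih fun i => hf i.succ,
      ← lintegral_prod_mul (hf 0).aemeasurable hm.aemeasurable,
      ← (measurePreserving_piFinSuccAbove (fun _ : Fin (k + 1) => μ) 0).lintegral_comp
        (f := fun z => f 0 z.1 * ∏ i, f (Fin.succ i) (z.2 i))
        ((hf 0).comp measurable_fst |>.mul (hm.comp measurable_snd))]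
    refine lintegral_congr fun x => ?_
    simp [Fin.prod_univ_succ, MeasurableEquiv.piFinSuccAbove, Fin.tail]

theorem pi_withDensity (μ : Measure X) [SigmaFinite μ] (k : ℕ) {f : X → ℝ≥0∞}
    (hf : Measurable f) [SigmaFinite (μ.withDensity f)] :
    Measure.pi (fun _ : Fin k => μ.withDensity f) =
      (Measure.pi fun _ : Fin k => μ).withDensity fun x => ∏ i, f (x i) := by
  refine Measure.pi_eq fun s hs => ?_
  rw [withDensity_apply _ (MeasurableSet.univ_pi hs),
    ← lintegral_indicator (MeasurableSet.univ_pi hs)]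
  have h := lintegral_fin_prod μ (f := fun i => (s i).indicator f) fun i => hf.indicator (hs i)
  simp only [lintegral_indicator (hs _), ← withDensity_apply f (hs _)] at h
  rw [← h]
  refine lintegral_congr fun x => ?_
  by_cases hx : x ∈ Set.univ.pi s
  · rw [Set.indicator_of_mem hx]
    exact Finset.prod_congr rfl fun i _ => (Set.indicator_of_mem (hx i trivial) _).symm
  · rw [Set.indicator_of_notMem hx]
    simp only [Set.mem_pi, Set.mem_univ, true_imp_iff, not_forall] at hx
    obtain ⟨i, hi⟩ := hx
    exact (Finset.prod_eq_zero (Finset.mem_univ i) (Set.indicator_of_notMem hi _)).symm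

theorem measurable_initial (k : ℕ) : Measurable fun (ξ : ℕ → X) (i : Fin k) => ξ i :=
  measurable_pi_lambda _ fun _ => measurable_pi_apply _

theorem map_infinitePi_initial (m : Measure X) [IsProbabilityMeasure m] (k : ℕ) :
    (Measure.infinitePi fun _ : ℕ => m).map (fun ξ (i : Fin k) => ξ i) =
      Measure.pi fun _ : Fin k => m := by
  rw [← Measure.infinitePi_eq_pi]
  exact Measure.map_infinitePi_infinitePi_of_inj Fin.val_injective

theorem exists_initial_of_mem_measurableCylinders {s : Set (ℕ → X)}
    (hs : s ∈ measurableCylinders fun _ : ℕ => X) :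
    ∃ (k : ℕ) (E : Set (Fin k → X)), MeasurableSet E ∧ s = {ξ | (fun i : Fin k => ξ i) ∈ E} := by
  obtain ⟨I, S, hS, rfl⟩ := (mem_measurableCylinders _).1 hs
  have hI : ∀ i : I, (i : ℕ) < I.sup id + 1 := fun i =>
    Nat.lt_succ_of_le (Finset.le_sup (f := id) i.2)
  -- A cylinder over any finite index set is one over the initial segment that ends at the largest
  -- index.
  refine ⟨I.sup id + 1, (fun x (i : I) => x ⟨i, hI i⟩) ⁻¹' S, ?_, ?_⟩
  · exact (measurable_pi_lambda _ fun _ => measurable_pi_apply _) hS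
  · rfl

end ProductMeasure

/-! ### The outcome law as a mixture of i.i.d. laws -/

section OutcomeLaw

variable {X : Type*} [MeasurableSpace X] {μ : Measure X} {V : X → ℝ → ℂ}

theorem IsJumpFamily.measurable_likelihood (hV : IsJumpFamily μ V) :
    Measurable fun p : X × ℝ => likelihood V p.1 p.2 :=
  (hV.measurable.norm).pow_const 2

theorem IsJumpFamily.measurable_likelihood_left (hV : IsJumpFamily μ V) (ν : ℝ) :
    Measurable fun ξ => likelihood V ξ ν :=
  hV.measurable_likelihood.comp measurable_prodMk_right

theorem IsJumpFamily.measurable_likelihood_right (hV : IsJumpFamily μ V) (ξ : X) :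
    Measurable (likelihood V ξ) :=
  hV.measurable_likelihood.comp measurable_prodMk_left

theorem IsJumpFamily.isProbabilityMeasure (hV : IsJumpFamily μ V) (ν : ℝ) :
    IsProbabilityMeasure (outcomeMeasure μ V ν) := by
  refine ⟨?_⟩
  rw [outcomeMeasure, withDensity_apply _ MeasurableSet.univ, Measure.restrict_univ]
  exact hV.normalized ν

/-- The law `μ_ν^{⊗ℕ}` of the outcomes when the observable has the value `ν`. -/
noncomputable def sequenceLaw (μ : Measure X) (V : X → ℝ → ℂ) (hV : IsJumpFamily μ V) (ν : ℝ) :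
    Measure (ℕ → X) :=
  have := hV.isProbabilityMeasure ν
  Measure.infinitePi fun _ => outcomeMeasure μ V ν

instance isProbabilityMeasure_sequenceLaw (hV : IsJumpFamily μ V) (ν : ℝ) :
    IsProbabilityMeasure (sequenceLaw μ V hV ν) := by
  have := hV.isProbabilityMeasure ν
  unfold sequenceLaw
  infer_instance

theorem sequenceLaw_initial [SigmaFinite μ] (hV : IsJumpFamily μ V) (ν : ℝ) {k : ℕ}
    {E : Set (Fin k → X)} (hE : MeasurableSet E) :
    sequenceLaw μ V hV ν {ξ | (fun i : Fin k => ξ i) ∈ E} =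
      ∫⁻ ξ in E, ENNReal.ofReal (∏ i, likelihood V (ξ i) ν) ∂(Measure.pi fun _ : Fin k => μ) := by
  have := hV.isProbabilityMeasure ν
  have hp : SigmaFinite (μ.withDensity fun ξ => ENNReal.ofReal (likelihood V ξ ν)) := by
    have : IsProbabilityMeasure (μ.withDensity fun ξ => ENNReal.ofReal (likelihood V ξ ν)) := this
    infer_instance
  have h1 : {ξ : ℕ → X | (fun i : Fin k => ξ i) ∈ E} = (fun ξ (i : Fin k) => ξ i) ⁻¹' E := rfl
  rw [h1, sequenceLaw, ← Measure.map_apply (measurable_initial k) hE, map_infinitePi_initial]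
  simp only [outcomeMeasure]
  rw [pi_withDensity μ k (hV.measurable_likelihood_left ν).ennreal_ofReal, withDensity_apply _ hE]
  simp only [ENNReal.ofReal_prod_of_nonneg fun i _ => likelihood_nonneg V _ ν]

theorem measurable_prod_likelihood (hV : IsJumpFamily μ V) (k : ℕ) :
    Measurable fun p : (Fin k → X) × ℝ => ∏ i, likelihood V (p.1 i) p.2 := by
  refine Finset.measurable_fun_prod _ fun i _ => ?_
  exact hV.measurable_likelihood.comp (f := fun p : (Fin k → X) × ℝ => (p.1 i, p.2))
    (((measurable_pi_apply i).comp measurable_fst).prodMk measurable_snd)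

/-- Cylinders form a generating π-system, on which the mass is a parametric integral of a jointly
measurable density. This makes `sequenceLaw` a kernel, so that the mixture by `bind` has its
expected values. -/
theorem measurable_sequenceLaw [SigmaFinite μ] (hV : IsJumpFamily μ V) :
    Measurable (sequenceLaw μ V hV) := by
  refine .measure_of_isPiSystem_of_isProbabilityMeasure generateFrom_measurableCylinders.symm
    isPiSystem_measurableCylinders fun s hs => ?_
  obtain ⟨k, E, hE, rfl⟩ := exists_initial_of_mem_measurableCylinders hs
  simp only [sequenceLaw_initial hV _ hE]
  exact (measurable_prod_likelihood hV k).ennreal_ofReal.lintegral_prod_left'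

variable {H : Type*} [NormedAddCommGroup H] [InnerProductSpace ℂ H] [CompleteSpace H]
variable {N : H →L[ℂ] H} (hN : IsSelfAdjoint N) {ρ : H →L[ℂ] H}

/-- Tonelli exchanges the integrals over `ν` and over the outcomes; the inner integral over `ν` is
then the trace. This also proves that `ℙ_ρ` exists. -/
theorem isOutcomeLaw_bind [SigmaFinite μ] (hV : IsJumpFamily μ V) (hρ : IsDensityMatrix ρ) :
    IsOutcomeLaw N hN μ V ρ ((stateSpectralMeasure N hN ρ).bind (sequenceLaw μ V hV)) := by
  intro k E hE
  have := isProbabilityMeasure_stateSpectralMeasure hN hρ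
  rw [Measure.bind_apply (s := {ξ : ℕ → X | (fun i : Fin k => ξ i) ∈ E}) ((measurable_initial k) hE)
    (measurable_sequenceLaw hV).aemeasurable]
  simp only [sequenceLaw_initial hV _ hE]
  rw [lintegral_lintegral_swap]
  · refine lintegral_congr fun ξ => ?_
    rw [trace_unnormalizedPosterior hN hV hρ, Complex.ofReal_re,
      ofReal_integral_eq_lintegral_ofReal]
    · have hm : Measurable fun ν => ∏ i, likelihood V (ξ i) ν :=
        Finset.measurable_fun_prod _ fun i _ => hV.measurable_likelihood_right _
      obtain ⟨C, hC⟩ := hV.exists_prod_bound ξ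
      refine Integrable.of_bound hm.aestronglyMeasurable (C ^ 2) (Eventually.of_forall fun ν => ?_)
      rw [Real.norm_of_nonneg (Finset.prod_nonneg fun i _ => likelihood_nonneg V _ ν)]
      simp only [likelihood, Finset.prod_pow, ← norm_prod]
      exact pow_le_pow_left₀ (norm_nonneg _) (hC ν) 2
    · exact Eventually.of_forall fun ν => Finset.prod_nonneg fun i _ => likelihood_nonneg V _ ν
  · exact ((measurable_prod_likelihood hV k).comp measurable_swap).ennreal_ofReal.aemeasurable

theorem isOutcomeLaw_outcomeLaw [SigmaFinite μ] (hV : IsJumpFamily μ V) (hρ : IsDensityMatrix ρ) :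
    IsOutcomeLaw N hN μ V ρ (outcomeLaw N hN μ V ρ) := by
  have h : ∃ P, IsOutcomeLaw N hN μ V ρ P := ⟨_, isOutcomeLaw_bind hN hV hρ⟩
  rw [outcomeLaw, dif_pos h]
  exact h.choose_spec

/-- The outcome law is the mixture of the laws `μ_ν^{⊗ℕ}` under the spectral measure. -/
theorem outcomeLaw_eq [SigmaFinite μ] (hV : IsJumpFamily μ V) (hρ : IsDensityMatrix ρ) :
    outcomeLaw N hN μ V ρ = (stateSpectralMeasure N hN ρ).bind (sequenceLaw μ V hV) := by
  have h1 := isOutcomeLaw_outcomeLaw hN hV hρ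
  have h2 := isOutcomeLaw_bind hN hV hρ
  have := isProbabilityMeasure_stateSpectralMeasure hN hρ
  have h3 : ∀ s ∈ measurableCylinders fun _ : ℕ => X,
      (stateSpectralMeasure N hN ρ).bind (sequenceLaw μ V hV) s = outcomeLaw N hN μ V ρ s :=
    fun s hs => by
      obtain ⟨k, E, hE, rfl⟩ := exists_initial_of_mem_measurableCylinders hs
      rw [h1 k E hE, h2 k E hE]
  have hfin : IsFiniteMeasure ((stateSpectralMeasure N hN ρ).bind (sequenceLaw μ V hV)) := by
    refine ⟨?_⟩
    rw [Measure.bind_apply MeasurableSet.univ (measurable_sequenceLaw hV).aemeasurable]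
    simp
  exact (ext_of_generate_finite _ generateFrom_measurableCylinders.symm
    isPiSystem_measurableCylinders h3 (h3 _ (univ_mem_measurableCylinders _))).symm

/-- The transfer from each i.i.d. law to the mixture. Measurability of the event is what allows its
mass to be computed fibrewise. -/
theorem ae_outcomeLaw_of_ae [SigmaFinite μ] (hV : IsJumpFamily μ V) (hρ : IsDensityMatrix ρ)
    {p : (ℕ → X) → Prop} (hp : MeasurableSet {ξ | p ξ})
    (h : ∀ᵐ ν ∂(stateSpectralMeasure N hN ρ), ∀ᵐ ξ ∂(sequenceLaw μ V hV ν), p ξ) :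
    ∀ᵐ ξ ∂(outcomeLaw N hN μ V ρ), p ξ := by
  rw [outcomeLaw_eq hN hV hρ, ae_iff, ← Set.compl_ofPred,
    Measure.bind_apply hp.compl (measurable_sequenceLaw hV).aemeasurable,
    lintegral_eq_zero_iff (f := fun ν => sequenceLaw μ V hV ν {ξ | p ξ}ᶜ)
      ((Measure.measurable_coe hp.compl).comp (measurable_sequenceLaw hV))]
  exact h

end OutcomeLaw

/-! ### Laplace's principle -/

section Laplace

/-- Laplace's principle: if `G_k = exp (k F_k)` on `C` and `F_k → h` uniformly on `C`, then
`(1/k) log ∫_C G_k` converges to the essential supremum of `h` on `C`. -/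
theorem tendsto_log_setIntegral_exp {α : Type*} [MeasurableSpace α] {m : Measure α}
    [IsFiniteMeasure m] {C : Set α} (hC : MeasurableSet C) {F G : ℕ → α → ℝ} {h : α → ℝ} {a : ℝ}
    (hG : ∀ k, IntegrableOn (G k) C m) (hF : TendstoUniformlyOn F h atTop C)
    (hGF : ∀ k, ∀ x ∈ C, G k x = Real.exp (k * F k x)) (hle : ∀ x ∈ C, h x ≤ a)
    (hpos : ∀ ε > 0, ∃ D ⊆ C, MeasurableSet D ∧ 0 < m D ∧ ∀ x ∈ D, a - ε < h x) :
    Tendsto (fun k : ℕ => (1 / k : ℝ) * Real.log (∫ x in C, G k x ∂m)) atTop (𝓝 a) := by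
  rw [Metric.tendsto_atTop']
  intro ε hε
  -- The error `ε` is split in quarters: one for `h` on `D`, one for the uniform distance of `F k`
  -- from `h`, and one for `log (mass) / k`. The lower bound pays the first two, which explains `a -
  -- ε / 2` below.
  obtain ⟨D, hDC, hD, hmD, hDh⟩ := hpos (ε / 4) (by positivity)
  have hmD' : 0 < m.real D := ENNReal.toReal_pos hmD.ne' (measure_ne_top _ _)
  have hmC' : 0 < m.real C := hmD'.trans_le (measureReal_mono hDC)
  have e1 : ∀ᶠ k : ℕ in atTop, Real.log (m.real C) / k < ε / 4 :=
    (tendsto_const_div_atTop_nhds_zero_nat _).eventually_lt_const (by positivity)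
  have e2 : ∀ᶠ k : ℕ in atTop, -(ε / 4) < Real.log (m.real D) / k :=
    (tendsto_const_div_atTop_nhds_zero_nat _).eventually_const_lt (by linarith)
  have e3 := Metric.tendstoUniformlyOn_iff.1 hF (ε / 4) (by positivity)
  obtain ⟨K, hK⟩ := eventually_atTop.1 (e1.and (e2.and (e3.and (eventually_gt_atTop 0))))
  refine ⟨K, fun k hk => ?_⟩
  obtain ⟨h1, h2, h3, h4⟩ := hK k hk.le
  have hk0 : (0 : ℝ) < k := by exact_mod_cast h4
  have hup : ∫ x in C, G k x ∂m ≤ Real.exp (k * (a + ε / 4)) * m.real C := by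
    have := setIntegral_mono_on (hG k) (integrableOn_const (C := Real.exp (k * (a + ε / 4)))) hC
      fun x hx => ?_
    · rwa [setIntegral_const, smul_eq_mul, mul_comm] at this
    · rw [hGF k x hx]
      have h5 := h3 x hx
      rw [Real.dist_eq, abs_lt] at h5
      have h6 := hle x hx
      gcongr
      linarith
  have hlow : Real.exp (k * (a - ε / 2)) * m.real D ≤ ∫ x in C, G k x ∂m := by
    have h7 : ∫ x in D, G k x ∂m ≤ ∫ x in C, G k x ∂m :=
      setIntegral_mono_set (hG k) ((ae_restrict_iff' hC).2 (Eventually.of_forall fun x hx => by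
        rw [hGF k x hx]; exact (Real.exp_pos _).le)) hDC.eventuallyLE
    refine le_trans ?_ h7
    have := setIntegral_mono_on (integrableOn_const (C := Real.exp (k * (a - ε / 2))))
      ((hG k).mono_set hDC) hD fun x hx => ?_
    · rwa [setIntegral_const, smul_eq_mul, mul_comm] at this
    · rw [hGF k x (hDC hx)]
      have h5 := h3 x (hDC hx)
      rw [Real.dist_eq, abs_lt] at h5
      have h6 := hDh x hx
      gcongr
      linarith
  have hl0 : 0 < Real.exp (k * (a - ε / 2)) * m.real D := by positivity
  have l1 := Real.log_le_log hl0 hlow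
  have l2 := Real.log_le_log (hl0.trans_le hlow) hup
  rw [Real.log_mul (Real.exp_pos _).ne' hmD'.ne', Real.log_exp] at l1
  rw [Real.log_mul (Real.exp_pos _).ne' hmC'.ne', Real.log_exp] at l2
  rw [div_lt_iff₀ hk0] at h1
  rw [lt_div_iff₀ hk0] at h2
  rw [Real.dist_eq, abs_lt, one_div_mul_eq_div, lt_sub_iff_add_lt, sub_lt_iff_lt_add,
    lt_div_iff₀ hk0, div_lt_iff₀ hk0]
  constructor <;> nlinarith

end Laplace

/-! ### Random continuous functions and the strong law -/

section ContinuousMap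

/-- The Borel sets of `C(K, ℝ)` are generated by evaluations: by continuity a closed ball is cut out
by conditions at countably many points, and every open set is a countable union of closed balls. -/
theorem measurable_continuousMap {α K : Type*} [MeasurableSpace α] [MetricSpace K] [CompactSpace K]
    [MeasurableSpace C(K, ℝ)] [BorelSpace C(K, ℝ)] {φ : α → C(K, ℝ)}
    (h : ∀ x, Measurable fun a => φ a x) : Measurable φ := by
  obtain ⟨d, hdc, hd⟩ := TopologicalSpace.exists_countable_dense K
  have hball : ∀ (f : C(K, ℝ)) (r : ℝ), 0 ≤ r → MeasurableSet (φ ⁻¹' Metric.closedBall f r) :=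
    fun f r hr => by
      have : φ ⁻¹' Metric.closedBall f r = ⋂ x ∈ d, {a | dist (φ a x) (f x) ≤ r} := by
        ext a
        simp only [Set.mem_preimage, Metric.mem_closedBall, ContinuousMap.dist_le hr,
          Set.mem_iInter, Set.mem_ofPred_eq]
        refine ⟨fun H x _ => H x, fun H x => ?_⟩
        exact hd.induction H (isClosed_le (by fun_prop) continuous_const) x
      rw [this]
      exact MeasurableSet.biInter hdc fun x _ =>
        measurableSet_le ((h x).dist measurable_const) measurable_const
  refine measurable_of_isOpen fun U hU => ?_
  have hr : ∀ f : C(K, ℝ), ∃ r > 0, f ∈ U → Metric.closedBall f r ⊆ U := fun f => by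
    by_cases hf : f ∈ U
    · obtain ⟨r, hr, hrU⟩ := Metric.nhds_basis_closedBall.mem_iff.1 (hU.mem_nhds hf)
      exact ⟨r, hr, fun _ => hrU⟩
    · exact ⟨1, one_pos, fun h => absurd h hf⟩
  choose r hr0 hrU using hr
  obtain ⟨t, htU, htc, ht⟩ := TopologicalSpace.countable_cover_nhdsWithin (s := U)
    (f := fun f => Metric.closedBall f (r f))
    fun f _ => mem_nhdsWithin_of_mem_nhds (Metric.closedBall_mem_nhds f (hr0 f))
  have : φ ⁻¹' U = ⋃ f ∈ t, φ ⁻¹' Metric.closedBall f (r f) := by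
    rw [← Set.preimage_iUnion₂]
    congr 1
    exact ht.antisymm (Set.iUnion₂_subset fun f hf => hrU f (htU hf))
  rw [this]
  exact MeasurableSet.biUnion htc fun f _ => hball f _ (hr0 f).le

open ProbabilityTheory in
/-- Strong law of large numbers for functions of the coordinates of an infinite product. -/
theorem strong_law_infinitePi {X E : Type*} [MeasurableSpace X] [NormedAddCommGroup E]
    [NormedSpace ℝ E] [CompleteSpace E] [MeasurableSpace E] [BorelSpace E] (m : Measure X)
    [IsProbabilityMeasure m] {Y : X → E} (hY : Measurable Y) (hi : Integrable Y m) :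
    ∀ᵐ ξ ∂(Measure.infinitePi fun _ : ℕ => m),
      Tendsto (fun k : ℕ => (k : ℝ)⁻¹ • ∑ j ∈ Finset.range k, Y (ξ j)) atTop (𝓝 (∫ x, Y x ∂m)) := by
  have hmp : ∀ i : ℕ, MeasurePreserving (Function.eval i) (Measure.infinitePi fun _ : ℕ => m) m :=
    fun i => measurePreserving_eval_infinitePi (fun _ : ℕ => m) i
  have h := strong_law_ae (μ := Measure.infinitePi fun _ : ℕ => m) (fun i ξ => Y (ξ i))
    ((hmp 0).integrable_comp_of_integrable hi)
    (fun i j hij => (iIndepFun_infinitePi (P := fun _ : ℕ => m) (X := fun _ => Y)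
      fun _ => hY).indepFun hij)
    (fun i => ⟨(hY.comp (measurable_pi_apply i)).aemeasurable,
      (hY.comp (measurable_pi_apply 0)).aemeasurable, by
        have e : ∀ i : ℕ, (Measure.infinitePi fun _ : ℕ => m).map (fun ξ => Y (ξ i)) = m.map Y :=
          fun i => (Measure.map_map hY (measurable_pi_apply i)).symm.trans
            (congrArg (Measure.map Y) (hmp i).map_eq)
        rw [e i, e 0]⟩)
  have h2 : ∫ ξ, Y (ξ 0) ∂(Measure.infinitePi fun _ : ℕ => m) = ∫ x, Y x ∂m := by
    conv_rhs => rw [← (hmp 0).map_eq]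
    rw [integral_map (measurable_pi_apply 0).aemeasurable
      (by rw [(hmp 0).map_eq]; exact hi.1)]
  rwa [h2] at h

end ContinuousMap

/-! ### Uniform law of large numbers and Gibbs' inequality -/

section LogLikelihood

variable {X : Type*} [MeasurableSpace X] {μ : Measure X} {V : X → ℝ → ℂ} {σ : Set ℝ}

omit [MeasurableSpace X] in
theorem toReal_logLikelihood (V : X → ℝ → ℂ) (ν : ℝ) (ξ : X) :
    (logLikelihood V ν ξ).toReal = Real.log (likelihood V ξ ν) := by
  rw [logLikelihood, ENNReal.log_ofReal]
  split_ifs with h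
  · rw [le_antisymm h (likelihood_nonneg V ξ ν)]
    simp
  · simp

omit [MeasurableSpace X] in
theorem logLikelihood_of_pos {ν : ℝ} {ξ : X} (h : 0 < likelihood V ξ ν) :
    logLikelihood V ν ξ = (Real.log (likelihood V ξ ν) : ℝ) :=
  ENNReal.log_ofReal_of_pos h

/-- The dominating function `sup_{ν ∈ σ} |l(ν|ξ)|`. -/
noncomputable def logEnvelope (V : X → ℝ → ℂ) (σ : Set ℝ) (ξ : X) : ℝ≥0∞ :=
  ⨆ ν ∈ σ, (logLikelihood V ν ξ).abs

theorem continuous_ereal_abs : Continuous EReal.abs := by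
  have : EReal.abs = fun x => max x.toENNReal (-x).toENNReal := by
    funext x
    induction x with
    | bot => simp
    | top => simp
    | coe x =>
      rw [EReal.abs_def, ← EReal.coe_neg, EReal.toENNReal_of_ne_top (EReal.coe_ne_top _),
        EReal.toENNReal_of_ne_top (EReal.coe_ne_top _), EReal.toReal_coe, EReal.toReal_coe]
      exact ENNReal.ofReal_mono.map_max
  rw [this]
  fun_prop

-- A single zero of the likelihood on `σ` would give `|-∞| = ∞` in the envelope.
omit [MeasurableSpace X] in
theorem likelihood_pos_of_logEnvelope_lt_top {ξ : X} (h : logEnvelope V σ ξ < ∞) {ν : ℝ}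
    (hν : ν ∈ σ) : 0 < likelihood V ξ ν := by
  refine (likelihood_nonneg V ξ ν).lt_of_ne fun h0 => ?_
  have h1 : (logLikelihood V ν ξ).abs ≤ logEnvelope V σ ξ :=
    le_iSup₂ (f := fun ν _ => (logLikelihood V ν ξ).abs) ν hν
  rw [logLikelihood, ← h0, ENNReal.ofReal_zero, ENNReal.log_zero, EReal.abs_bot] at h1
  exact (h1.trans_lt h).ne rfl

/-- The supremum is over an uncountable set; continuity in `ν`, as a map to the extended reals,
reduces it to a countable dense subset. -/
theorem measurable_logEnvelope (hV : IsJumpFamily μ V)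
    (hc : ∀ ξ, ContinuousOn (fun ν => likelihood V ξ ν) σ) : Measurable (logEnvelope V σ) := by
  obtain ⟨d, hdc, hd⟩ := TopologicalSpace.exists_countable_dense σ
  have h : logEnvelope V σ = fun ξ => ⨆ ν ∈ d, (logLikelihood V ν ξ).abs := by
    funext ξ
    have hcont : Continuous fun ν : σ => (logLikelihood V ν ξ).abs :=
      continuous_ereal_abs.comp (ENNReal.continuous_log.comp
        (ENNReal.continuous_ofReal.comp (hc ξ).domRestrict))
    refine le_antisymm (iSup₂_le fun ν hν => ?_)
      (iSup₂_le fun ν hν => le_iSup₂ (f := fun ν _ => (logLikelihood V ν ξ).abs) ν.1 ν.2)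
    exact hd.induction (P := fun ν : σ => (logLikelihood V ν ξ).abs ≤
      ⨆ ν ∈ d, (logLikelihood V ν ξ).abs)
      (fun x hx => le_iSup₂ (f := fun (ν : σ) _ => (logLikelihood V ν ξ).abs) x hx)
      (isClosed_le hcont continuous_const) ⟨ν, hν⟩
  rw [h]
  refine Measurable.biSup d hdc fun ν _ => ?_
  exact continuous_ereal_abs.measurable.comp (ENNReal.measurable_log.comp
    (hV.measurable_likelihood_left ν).ennreal_ofReal)

open Classical in
/-- The log-likelihood as a continuous function on `σ` (zero where it is not finite on `σ`). -/
noncomputable def logLikelihoodMap (V : X → ℝ → ℂ) (σ : Set ℝ)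
    (hc : ∀ ξ, ContinuousOn (fun ν => likelihood V ξ ν) σ) (ξ : X) : C(σ, ℝ) :=
  if h : logEnvelope V σ ξ < ∞ then
    ⟨fun ν => Real.log (likelihood V ξ ν), (hc ξ).domRestrict.log fun ν =>
      (likelihood_pos_of_logEnvelope_lt_top h ν.2).ne'⟩
  else 0

omit [MeasurableSpace X] in
theorem logLikelihoodMap_apply (hc : ∀ ξ, ContinuousOn (fun ν => likelihood V ξ ν) σ) {ξ : X}
    (h : logEnvelope V σ ξ < ∞) (ν : σ) :
    logLikelihoodMap V σ hc ξ ν = Real.log (likelihood V ξ ν) := by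
  rw [logLikelihoodMap, dif_pos h]
  rfl

variable [CompactSpace σ]

theorem measurable_logLikelihoodMap [MeasurableSpace C(σ, ℝ)] [BorelSpace C(σ, ℝ)]
    (hV : IsJumpFamily μ V) (hc : ∀ ξ, ContinuousOn (fun ν => likelihood V ξ ν) σ) :
    Measurable (logLikelihoodMap V σ hc) := by
  refine measurable_continuousMap fun ν => ?_
  have : (fun ξ => logLikelihoodMap V σ hc ξ ν) =
      {ξ | logEnvelope V σ ξ < ∞}.indicator fun ξ => Real.log (likelihood V ξ ν) := by
    funext ξ
    by_cases h : logEnvelope V σ ξ < ∞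
    · rw [logLikelihoodMap_apply hc h, Set.indicator_of_mem (by exact h)]
    · rw [logLikelihoodMap, dif_neg h, Set.indicator_of_notMem (by exact h)]
      rfl
  rw [this]
  exact (hV.measurable_likelihood_left ν).log.indicator
    (measurableSet_lt (measurable_logEnvelope hV hc) measurable_const)

omit [MeasurableSpace X] in
theorem enorm_logLikelihoodMap_le (hc : ∀ ξ, ContinuousOn (fun ν => likelihood V ξ ν) σ) (ξ : X) :
    ‖logLikelihoodMap V σ hc ξ‖ₑ ≤ logEnvelope V σ ξ := by
  by_cases h : logEnvelope V σ ξ < ∞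
  · rw [← ofReal_norm, ← ENNReal.ofReal_toReal h.ne]
    refine ENNReal.ofReal_le_ofReal ((ContinuousMap.norm_le _ ENNReal.toReal_nonneg).2 fun ν => ?_)
    rw [logLikelihoodMap_apply hc h, Real.norm_eq_abs, ← ENNReal.ofReal_le_iff_le_toReal h.ne,
      ← EReal.abs_def, ← logLikelihood_of_pos (likelihood_pos_of_logEnvelope_lt_top h ν.2)]
    exact le_iSup₂ (f := fun ν _ => (logLikelihood V ν ξ).abs) ν.1 ν.2
  · simp [not_lt_top_iff.1 h]

omit [CompactSpace σ] in
theorem ae_logEnvelope_lt_top (hV : IsJumpFamily μ V) (hf : LikelihoodAssumption μ V σ) {ν : ℝ}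
    (hν : ν ∈ σ) : ∀ᵐ ξ ∂(outcomeMeasure μ V ν), logEnvelope V σ ξ < ∞ :=
  ae_lt_top (measurable_logEnvelope hV hf.continuousOn) (hf.dominated ν hν).ne

/-- The envelope bounds the sup norm, so dominance gives Bochner integrability in `C(σ, ℝ)`. -/
theorem integrable_logLikelihoodMap (hV : IsJumpFamily μ V) (hf : LikelihoodAssumption μ V σ)
    {ν : ℝ} (hν : ν ∈ σ) :
    Integrable (logLikelihoodMap V σ hf.continuousOn) (outcomeMeasure μ V ν) := by
  borelize C(σ, ℝ)
  refine ⟨(measurable_logLikelihoodMap hV hf.continuousOn).aestronglyMeasurable, ?_⟩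
  exact (lintegral_mono fun ξ => enorm_logLikelihoodMap_le hf.continuousOn ξ).trans_lt
    (hf.dominated ν hν)

/-- The expected log-likelihood `𝔼_ν[l(ν'|ξ)]`. -/
noncomputable def expectedLog (μ : Measure X) (V : X → ℝ → ℂ) (ν ν' : ℝ) : ℝ :=
  ∫ ξ, Real.log (likelihood V ξ ν') ∂(outcomeMeasure μ V ν)

theorem integrable_log_likelihood (hV : IsJumpFamily μ V) (hf : LikelihoodAssumption μ V σ)
    {ν ν' : ℝ} (hν : ν ∈ σ) (hν' : ν' ∈ σ) :
    Integrable (fun ξ => Real.log (likelihood V ξ ν')) (outcomeMeasure μ V ν) := by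
  have h := (ContinuousMap.evalCLM ℝ (⟨ν', hν'⟩ : σ)).integrable_comp
    (integrable_logLikelihoodMap hV hf hν)
  refine h.congr ?_
  filter_upwards [ae_logEnvelope_lt_top hV hf hν] with ξ hξ
  exact logLikelihoodMap_apply hf.continuousOn hξ ⟨ν', hν'⟩

/-- Evaluation at a point is continuous and linear, hence commutes with the Bochner integral.
Continuity of `expectedLog` in its second argument then comes for free. -/
theorem integral_logLikelihoodMap_apply (hV : IsJumpFamily μ V) (hf : LikelihoodAssumption μ V σ)
    {ν : ℝ} (hν : ν ∈ σ) (ν' : σ) :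
    (∫ ξ, logLikelihoodMap V σ hf.continuousOn ξ ∂(outcomeMeasure μ V ν)) ν' =
      expectedLog μ V ν ν' := by
  have h := (ContinuousMap.evalCLM ℝ ν').integral_comp_comm (integrable_logLikelihoodMap hV hf hν)
  refine h.symm.trans (integral_congr_ae ?_)
  filter_upwards [ae_logEnvelope_lt_top hV hf hν] with ξ hξ
  exact logLikelihoodMap_apply hf.continuousOn hξ ν'

theorem continuousOn_expectedLog (hV : IsJumpFamily μ V) (hf : LikelihoodAssumption μ V σ)
    {ν : ℝ} (hν : ν ∈ σ) : ContinuousOn (expectedLog μ V ν) σ := by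
  rw [continuousOn_iff_continuous_domRestrict]
  convert (∫ ξ, logLikelihoodMap V σ hf.continuousOn ξ ∂(outcomeMeasure μ V ν)).continuous using 1
  funext ν'
  exact (integral_logLikelihoodMap_apply hV hf hν ν').symm

/-- Uniform law of large numbers for the log-likelihood. -/
theorem ae_tendstoUniformlyOn_log_likelihood (hV : IsJumpFamily μ V)
    (hf : LikelihoodAssumption μ V σ) {ν : ℝ} (hν : ν ∈ σ) :
    ∀ᵐ ξ ∂(sequenceLaw μ V hV ν), (∀ j, ∀ ν' ∈ σ, 0 < likelihood V (ξ j) ν') ∧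
      TendstoUniformlyOn (fun (k : ℕ) ν' => (k : ℝ)⁻¹ * ∑ j ∈ Finset.range k,
        Real.log (likelihood V (ξ j) ν')) (expectedLog μ V ν) atTop σ := by
  borelize C(σ, ℝ)
  have := hV.isProbabilityMeasure ν
  have h1 := strong_law_infinitePi (outcomeMeasure μ V ν)
    (measurable_logLikelihoodMap hV hf.continuousOn) (integrable_logLikelihoodMap hV hf hν)
  have h2 : ∀ᵐ ξ ∂(sequenceLaw μ V hV ν), ∀ j, logEnvelope V σ (ξ j) < ∞ :=
    ae_all_iff.2 fun j => (measurePreserving_eval_infinitePi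
      (fun _ : ℕ => outcomeMeasure μ V ν) j).quasiMeasurePreserving.ae
        (ae_logEnvelope_lt_top hV hf hν)
  filter_upwards [h1, h2] with ξ h3 h4
  refine ⟨fun j ν' hν' => likelihood_pos_of_logEnvelope_lt_top (h4 j) hν', ?_⟩
  rw [ContinuousMap.tendsto_iff_tendstoUniformly] at h3
  rw [tendstoUniformlyOn_iff_tendstoUniformly_comp_coe]
  convert h3 using 1
  · funext k ν'
    simp only [ContinuousMap.smul_apply, ContinuousMap.sum_apply, smul_eq_mul,
      logLikelihoodMap_apply hf.continuousOn (h4 _)]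
  · funext ν'
    exact (integral_logLikelihoodMap_apply hV hf hν ν').symm

/-- Gibbs' inequality: the expected log-likelihood has its unique maximum at the true value. -/
theorem expectedLog_lt (hV : IsJumpFamily μ V) (hf : LikelihoodAssumption μ V σ) {ν ν' : ℝ}
    (hν : ν ∈ σ) (hν' : ν' ∈ σ) (hne : ν' ≠ ν) : expectedLog μ V ν ν' < expectedLog μ V ν ν := by
  by_contra! hle
  have hp := hV.isProbabilityMeasure ν
  set p := outcomeMeasure μ V ν with hpdef
  have hm := hV.measurable_likelihood_left ν
  have hm' := hV.measurable_likelihood_left ν'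
  set r : X → ℝ := fun ξ => likelihood V ξ ν' / likelihood V ξ ν with hr
  have hrm : Measurable r := hm'.div hm
  have hr0 : ∀ ξ, 0 ≤ r ξ := fun ξ => div_nonneg (likelihood_nonneg V _ _) (likelihood_nonneg V _ _)
  -- Only an inequality: the part of `f(·|ν')` that lives where `f(·|ν) = 0` is lost.
  have hrl : ∫⁻ ξ, ENNReal.ofReal (r ξ) ∂p ≤ 1 := by
    rw [hpdef, outcomeMeasure, lintegral_withDensity_eq_lintegral_mul _ hm.ennreal_ofReal
      hrm.ennreal_ofReal, ← hV.normalized ν']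
    refine lintegral_mono fun ξ => ?_
    rw [Pi.mul_apply, ← ENNReal.ofReal_mul (likelihood_nonneg V _ _)]
    refine ENNReal.ofReal_le_ofReal ?_
    rcases (likelihood_nonneg V ξ ν).eq_or_lt with h | h
    · rw [← h, zero_mul]
      positivity
    · rw [hr]
      simp only
      rw [mul_div_cancel₀ _ h.ne']
      rfl
  have hri : Integrable r p := ⟨hrm.aestronglyMeasurable, by
    rw [hasFiniteIntegral_iff_ofReal (Eventually.of_forall hr0)]
    exact hrl.trans_lt ENNReal.one_lt_top⟩
  have hrI : ∫ ξ, r ξ ∂p ≤ 1 := by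
    rw [integral_eq_lintegral_of_nonneg_ae (Eventually.of_forall hr0) hrm.aestronglyMeasurable]
    exact ENNReal.toReal_le_of_le_ofReal zero_le_one (by simpa using hrl)
  have hi := integrable_log_likelihood hV hf hν hν
  have hi' := integrable_log_likelihood hV hf hν hν'
  -- The gap in `log r ≤ r - 1`. If the expected log-likelihood were not smaller at `ν'`, the
  -- nonnegative `φ` would have integral at most `0`, forcing `r = 1` almost surely.
  set φ : X → ℝ := fun ξ => r ξ - 1 -
    (Real.log (likelihood V ξ ν') - Real.log (likelihood V ξ ν)) with hφ
  have hφi : Integrable φ p := (hri.sub (integrable_const 1)).sub (hi'.sub hi)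
  have hφe : ∀ᵐ ξ ∂p, 0 < r ξ ∧ φ ξ = r ξ - 1 - Real.log (r ξ) := by
    filter_upwards [ae_logEnvelope_lt_top hV hf hν] with ξ hξ
    have h1 := likelihood_pos_of_logEnvelope_lt_top hξ hν
    have h2 := likelihood_pos_of_logEnvelope_lt_top hξ hν'
    exact ⟨div_pos h2 h1, by rw [hφ, hr]; simp only; rw [Real.log_div h2.ne' h1.ne']⟩
  have hφ0 : 0 ≤ᵐ[p] φ := by
    filter_upwards [hφe] with ξ hξ
    rw [hξ.2]
    have := Real.log_le_sub_one_of_pos hξ.1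
    simpa using by linarith
  have hφI : ∫ ξ, φ ξ ∂p ≤ 0 := by
    have e1 : ∫ ξ, φ ξ ∂p = (∫ ξ, (r ξ - 1) ∂p) -
        ∫ ξ, (Real.log (likelihood V ξ ν') - Real.log (likelihood V ξ ν)) ∂p :=
      integral_sub (hri.sub (integrable_const 1)) (hi'.sub hi)
    rw [e1, integral_sub hri (integrable_const 1), integral_sub hi' hi]
    simp only [integral_const, probReal_univ, smul_eq_mul, mul_one]
    have : expectedLog μ V ν ν ≤ expectedLog μ V ν ν' := hle
    simp only [expectedLog] at this
    linarith
  have hφz : φ =ᵐ[p] 0 := (integral_eq_zero_iff_of_nonneg_ae hφ0 hφi).1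
    (le_antisymm hφI (integral_nonneg_of_ae hφ0))
  have hff : ∀ᵐ ξ ∂p, likelihood V ξ ν = likelihood V ξ ν' := by
    filter_upwards [hφe, hφz] with ξ h1 h2
    have h3 : r ξ = 1 := by
      by_contra h
      have := Real.log_lt_sub_one_of_pos h1.1 h
      rw [h1.2, Pi.zero_apply] at h2
      linarith
    have h4 : likelihood V ξ ν ≠ 0 := fun h => by
      rw [hr] at h3
      simp [h] at h3
    exact ((div_eq_one_iff_eq h4).1 h3).symm
  rw [hpdef, outcomeMeasure, ae_withDensity_iff hm.ennreal_ofReal] at hff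
  -- The densities are known to agree only where `f(·|ν) > 0`; elsewhere the inequality is trivial.
  -- As both integrate to `1`, it is an equality almost everywhere, contradicting identifiability.
  have hffl : ∀ᵐ ξ ∂μ, likelihood V ξ ν ≤ likelihood V ξ ν' := by
    filter_upwards [hff] with ξ hξ
    rcases (likelihood_nonneg V ξ ν).eq_or_lt with h | h
    · rw [← h]
      exact likelihood_nonneg V ξ ν'
    · exact (hξ (by simpa using h)).le
  have hone : ∀ ν'' ∈ σ, ∫ ξ, likelihood V ξ ν'' ∂μ = 1 := fun ν'' _ => by
    rw [integral_eq_lintegral_of_nonneg_ae (Eventually.of_forall fun ξ => likelihood_nonneg V ξ ν'')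
      (hV.measurable_likelihood_left ν'').aestronglyMeasurable]
    simp only [likelihood, hV.normalized ν'', ENNReal.toReal_one]
  refine hf.identifiable ν hν ν' hν' hne.symm ?_
  exact (integral_eq_iff_of_ae_le (hf.integrable ν hν) (hf.integrable ν' hν') hffl).1
    ((hone ν hν).trans (hone ν' hν').symm)

end LogLikelihood

/-! ### Consistency of the maximum-likelihood estimator -/

section Consistency

/-- Maximizers of a uniformly convergent sequence converge to the unique maximizer of the limit. -/
theorem tendsto_of_isMaxOn {σ : Set ℝ} (hσ : IsCompact σ) {F : ℕ → ℝ → ℝ} {h : ℝ → ℝ}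
    (hc : ContinuousOn h σ) (hF : TendstoUniformlyOn F h atTop σ) {ν : ℝ} (hν : ν ∈ σ)
    (hlt : ∀ ν' ∈ σ, ν' ≠ ν → h ν' < h ν) {x : ℕ → ℝ}
    (hx : ∀ᶠ k in atTop, x k ∈ σ ∧ IsMaxOn (F k) σ (x k)) : Tendsto x atTop (𝓝 ν) := by
  refine tendsto_nhds.2 fun U hU hνU => ?_
  rcases (σ \ U).eq_empty_or_nonempty with he | hne
  · filter_upwards [hx] with k hk
    by_contra hkU
    exact Set.eq_empty_iff_forall_notMem.1 he (x k) ⟨hk.1, hkU⟩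
  · obtain ⟨y, hy, hymax⟩ := (hσ.diff hU).exists_isMaxOn hne (hc.mono Set.sdiff_subset)
    have hy1 : h y < h ν := hlt y hy.1 fun h => hy.2 (h ▸ hνU)
    have e := Metric.tendstoUniformlyOn_iff.1 hF ((h ν - h y) / 2) (by linarith)
    filter_upwards [hx, e] with k hk hek
    by_contra hkU
    have h1 : h (x k) ≤ h y := hymax ⟨hk.1, hkU⟩
    have h2 := hek (x k) hk.1
    have h3 := hek ν hν
    have h4 : F k ν ≤ F k (x k) := hk.2 hν
    rw [Real.dist_eq, abs_lt] at h2 h3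
    linarith

variable {X : Type*} [MeasurableSpace X] {μ : Measure X} {V : X → ℝ → ℂ} {σ : Set ℝ}

omit [MeasurableSpace X] in
theorem avgLogLikelihood_of_pos {k : ℕ} {ξ : ℕ → X} {ν : ℝ}
    (h : ∀ j, 0 < likelihood V (ξ j) ν) : avgLogLikelihood V k ξ ν =
      (((k : ℝ)⁻¹ * ∑ j ∈ Finset.range k, Real.log (likelihood V (ξ j) ν) : ℝ) : EReal) := by
  have hs : ∑ j ∈ Finset.range k, logLikelihood V ν (ξ j) =
      ((∑ j ∈ Finset.range k, Real.log (likelihood V (ξ j) ν) : ℝ) : EReal) := by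
    induction k with
    | zero => simp
    | succ k ih =>
      rw [Finset.sum_range_succ, Finset.sum_range_succ, EReal.coe_add, ih,
        logLikelihood_of_pos (h k)]
  rw [avgLogLikelihood, hs, one_div, EReal.coe_mul]

/-- Consistency of the maximum-likelihood estimator. -/
theorem ae_tendsto_maximumLikelihoodEstimator [CompactSpace σ] (hV : IsJumpFamily μ V)
    (hf : LikelihoodAssumption μ V σ) {Nhat : ℕ → (ℕ → X) → ℝ}
    (hNhat : IsMaximumLikelihoodEstimator V σ Nhat) {ν : ℝ} (hν : ν ∈ σ) :
    ∀ᵐ ξ ∂(sequenceLaw μ V hV ν), Tendsto (fun k => Nhat k ξ) atTop (𝓝 ν) := by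
  filter_upwards [ae_tendstoUniformlyOn_log_likelihood hV hf hν] with ξ ⟨hpos, hξ⟩
  refine tendsto_of_isMaxOn (isCompact_iff_compactSpace.2 inferInstance)
    (continuousOn_expectedLog hV hf hν) hξ hν (fun ν' hν' hne => expectedLog_lt hV hf hν hν' hne) ?_
  filter_upwards [eventually_ge_atTop 1] with k hk
  obtain ⟨h1, h2⟩ := (hNhat k hk).2 ξ
  refine ⟨h1, fun ν' hν' => ?_⟩
  have h3 : avgLogLikelihood V k ξ ν' ≤ avgLogLikelihood V k ξ (Nhat k ξ) := h2 hν'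
  rw [avgLogLikelihood_of_pos fun j => hpos j ν' hν',
    avgLogLikelihood_of_pos fun j => hpos j _ h1] at h3
  exact EReal.coe_le_coe_iff.1 h3

end Consistency

/-! ### Relative entropy: attainment and measurability -/

section RelativeEntropy

variable {X : Type*} [MeasurableSpace X] {μ : Measure X} {V : X → ℝ → ℂ} {σ : Set ℝ}
  [CompactSpace σ]

/-- The relative entropy is the gap between the maximum of the expected log-likelihood and its
maximum over `C`, the latter being attained. -/
theorem exists_relativeEntropy_eq (hV : IsJumpFamily μ V) (hf : LikelihoodAssumption μ V σ)
    {ν : ℝ} (hν : ν ∈ σ) {C : Set ℝ} (hC : IsCompact C) (hCne : C.Nonempty) (hCσ : C ⊆ σ) :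
    ∃ y ∈ C, IsMaxOn (expectedLog μ V ν) C y ∧
      relativeEntropy μ V ν C = expectedLog μ V ν ν - expectedLog μ V ν y := by
  obtain ⟨y, hy, hmax⟩ := hC.exists_isMaxOn hCne ((continuousOn_expectedLog hV hf hν).mono hCσ)
  refine ⟨y, hy, hmax, ?_⟩
  have he : ∀ ν' ∈ C, ∫ ξ, ((logLikelihood V ν ξ).toReal - (logLikelihood V ν' ξ).toReal)
      ∂(outcomeMeasure μ V ν) = expectedLog μ V ν ν - expectedLog μ V ν ν' := fun ν' hν' => by
    simp only [toReal_logLikelihood]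
    exact integral_sub (integrable_log_likelihood hV hf hν hν)
      (integrable_log_likelihood hV hf hν (hCσ hν'))
  rw [relativeEntropy, Set.image_congr he]
  refine IsLeast.csInf_eq ⟨⟨y, hy, rfl⟩, ?_⟩
  rintro _ ⟨z, hz, rfl⟩
  exact sub_le_sub_left (hmax hz) _

-- Moving the density into the integrand replaces the varying measure `μ_ν` by the fixed `μ`. The
-- map `a` covers both the diagonal and a constant second argument.
omit [CompactSpace σ] in
theorem measurable_expectedLog [SigmaFinite μ] (hV : IsJumpFamily μ V) {a : ℝ → ℝ}
    (ha : Measurable a) : Measurable fun ν => expectedLog μ V ν (a ν) := by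
  have h : (fun ν => expectedLog μ V ν (a ν)) =
      fun ν => ∫ ξ, likelihood V ξ ν * Real.log (likelihood V ξ (a ν)) ∂μ := by
    funext ν
    rw [expectedLog, outcomeMeasure, integral_withDensity_eq_integral_toReal_smul
      (hV.measurable_likelihood_left ν).ennreal_ofReal (by simp)]
    simp only [ENNReal.toReal_ofReal (likelihood_nonneg V _ ν), smul_eq_mul]
  rw [h]
  have hm : Measurable fun p : ℝ × X =>
      likelihood V p.2 p.1 * Real.log (likelihood V p.2 (a p.1)) :=
    (hV.measurable_likelihood.comp measurable_swap).mul
      (hV.measurable_likelihood.comp (f := fun p : ℝ × X => (p.2, a p.1))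
        (measurable_snd.prodMk (ha.comp measurable_fst))).log
  exact hm.stronglyMeasurable.integral_prod_right.measurable

/-- The infimum over a countable dense subset of `C` is measurable, and by continuity it is the full
minimum when `ν ∈ σ`. This representative makes the convergence event in the final theorem
measurable. -/
theorem exists_measurable_relativeEntropy [SigmaFinite μ] (hV : IsJumpFamily μ V)
    (hf : LikelihoodAssumption μ V σ) {C : Set ℝ} (hC : IsCompact C) (hCne : C.Nonempty)
    (hCσ : C ⊆ σ) : ∃ s : ℝ → ℝ, Measurable s ∧ ∀ ν ∈ σ, s ν = relativeEntropy μ V ν C := by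
  obtain ⟨d, hdc, hd⟩ := TopologicalSpace.exists_countable_dense C
  have := hdc.to_subtype
  have := hCne.to_subtype
  have hdne : Nonempty d := hd.nonempty.to_subtype
  refine ⟨fun ν => ⨅ z : d, (expectedLog μ V ν ν - expectedLog μ V ν z), ?_, fun ν hν => ?_⟩
  · exact Measurable.iInf fun z => (measurable_expectedLog hV measurable_id).sub
      (measurable_expectedLog hV measurable_const)
  · obtain ⟨y, hy, hmax, he⟩ := exists_relativeEntropy_eq hV hf hν hC hCne hCσ
    have hb : ∀ z : C, expectedLog μ V ν ν - expectedLog μ V ν y ≤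
        expectedLog μ V ν ν - expectedLog μ V ν z := fun z => sub_le_sub_left (hmax z.2) _
    rw [he]
    refine le_antisymm ?_ (le_ciInf fun z => hb z)
    have hbdd : BddBelow (Set.range fun z : d => expectedLog μ V ν ν - expectedLog μ V ν z) :=
      ⟨_, by rintro _ ⟨z, rfl⟩; exact hb z⟩
    have hcont : Continuous fun z : C => expectedLog μ V ν ν - expectedLog μ V ν z :=
      continuous_const.sub ((continuousOn_expectedLog hV hf hν).mono hCσ).domRestrict
    exact hd.induction (P := fun w : C => ⨅ z : d, (expectedLog μ V ν ν - expectedLog μ V ν z) ≤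
      expectedLog μ V ν ν - expectedLog μ V ν w) (fun w hw => ciInf_le hbdd ⟨w, hw⟩)
      (isClosed_le continuous_const hcont) ⟨y, hy⟩

end RelativeEntropy

/-! ### Exponential decay of the posterior mass -/

section Posterior

variable {X : Type*} [MeasurableSpace X] {μ : Measure X} {V : X → ℝ → ℂ} {σ : Set ℝ}

theorem integrable_prod_likelihood (hV : IsJumpFamily μ V) (m : Measure ℝ) [IsFiniteMeasure m]
    (ξ : ℕ → X) (k : ℕ) :
    Integrable (fun ν => ∏ j ∈ Finset.range k, likelihood V (ξ j) ν) m := by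
  have hm : Measurable fun ν => ∏ j ∈ Finset.range k, likelihood V (ξ j) ν :=
    Finset.measurable_fun_prod _ fun i _ => hV.measurable_likelihood_right _
  choose C hC using hV.bounded
  refine Integrable.of_bound hm.aestronglyMeasurable (∏ j ∈ Finset.range k, C (ξ j) ^ 2)
    (Eventually.of_forall fun ν => ?_)
  rw [Real.norm_of_nonneg (Finset.prod_nonneg fun i _ => likelihood_nonneg V _ ν)]
  exact Finset.prod_le_prod (fun i _ => likelihood_nonneg V _ ν)
    fun i _ => pow_le_pow_left₀ (norm_nonneg _) (hC _ ν) 2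

omit [MeasurableSpace X] in
theorem prod_likelihood_eq_exp {ξ : ℕ → X} {ν : ℝ} (h : ∀ j, 0 < likelihood V (ξ j) ν) (k : ℕ) :
    ∏ j ∈ Finset.range k, likelihood V (ξ j) ν =
      Real.exp (k * ((k : ℝ)⁻¹ * ∑ j ∈ Finset.range k, Real.log (likelihood V (ξ j) ν))) := by
  have h1 : ∏ j ∈ Finset.range k, likelihood V (ξ j) ν =
      Real.exp (∑ j ∈ Finset.range k, Real.log (likelihood V (ξ j) ν)) := by
    rw [Real.exp_sum]
    exact Finset.prod_congr rfl fun j _ => (Real.exp_log (h j)).symm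
  -- For `k = 0` both sides are `1`, the leading factor `k` killing the exponent.
  rcases Nat.eq_zero_or_pos k with rfl | hk
  · simp
  · have hk' : (k : ℝ) ≠ 0 := by exact_mod_cast hk.ne'
    rw [h1, mul_inv_cancel_left₀ hk']

theorem setIntegral_prod_likelihood_pos (hV : IsJumpFamily μ V) {m : Measure ℝ} [IsFiniteMeasure m]
    {C : Set ℝ} (hm : 0 < m C) {ξ : ℕ → X}
    (hpos : ∀ j, ∀ ν ∈ C, 0 < likelihood V (ξ j) ν) (k : ℕ) :
    0 < ∫ ν in C, ∏ j ∈ Finset.range k, likelihood V (ξ j) ν ∂m := by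
  rw [setIntegral_pos_iff_support_of_nonneg_ae
    (Eventually.of_forall fun ν => Finset.prod_nonneg fun i _ => likelihood_nonneg V _ ν)
    (integrable_prod_likelihood hV m ξ k).integrableOn]
  refine hm.trans_le (measure_mono fun ν hν => ⟨?_, hν⟩)
  exact (Finset.prod_pos fun j _ => hpos j ν hν).ne'

/-- Exponential rate at which the posterior mass of `C` decays. -/
theorem tendsto_log_posterior [CompactSpace σ] (hV : IsJumpFamily μ V)
    (hf : LikelihoodAssumption μ V σ) {m : Measure ℝ} [IsFiniteMeasure m]
    (hmσ : ∀ᵐ ν ∂m, ν ∈ σ) {C : Set ℝ} (hC : IsCompact C) (hCne : C.Nonempty) (hCσ : C ⊆ σ)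
    (hCm : ∀ y ∈ C, ∀ U ∈ 𝓝 y, 0 < m (U ∩ C)) {ν : ℝ} (hν : ν ∈ σ) (hνm : ν ∈ m.support)
    {ξ : ℕ → X} (hpos : ∀ j, ∀ ν' ∈ σ, 0 < likelihood V (ξ j) ν')
    (hξ : TendstoUniformlyOn (fun (k : ℕ) ν' => (k : ℝ)⁻¹ * ∑ j ∈ Finset.range k,
      Real.log (likelihood V (ξ j) ν')) (expectedLog μ V ν) atTop σ) :
    (∀ k, 0 < (∫ ν' in C, ∏ j ∈ Finset.range k, likelihood V (ξ j) ν' ∂m) /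
        ∫ ν', ∏ j ∈ Finset.range k, likelihood V (ξ j) ν' ∂m) ∧
      Tendsto (fun k : ℕ => -((1 / k : ℝ) * Real.log
        ((∫ ν' in C, ∏ j ∈ Finset.range k, likelihood V (ξ j) ν' ∂m) /
          ∫ ν', ∏ j ∈ Finset.range k, likelihood V (ξ j) ν' ∂m))) atTop
        (𝓝 (relativeEntropy μ V ν C)) := by
  have hσ : IsCompact σ := isCompact_iff_compactSpace.2 inferInstance
  have hσm : m.restrict σ = m := Measure.restrict_eq_self_of_ae_mem hmσ
  have hc := continuousOn_expectedLog hV hf hν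
  have hball : ∀ {D : Set ℝ} (_ : IsClosed D) (_ : D ⊆ σ) {y : ℝ} (_ : y ∈ D)
      (_ : ∀ U ∈ 𝓝 y, 0 < m (U ∩ D)), ∀ ε > 0, ∃ E ⊆ D, MeasurableSet E ∧ 0 < m E ∧
        ∀ x ∈ E, expectedLog μ V ν y - ε < expectedLog μ V ν x := by
    intro D hD hDσ y hy hU ε hε
    have h1 := (hc.mono hDσ y hy).eventually_const_lt (sub_lt_self (expectedLog μ V ν y) hε)
    obtain ⟨U, hUo, hyU, hUs⟩ := mem_nhdsWithin.1 h1
    exact ⟨U ∩ D, Set.inter_subset_right, hUo.measurableSet.inter hD.measurableSet,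
      hU U (hUo.mem_nhds hyU), fun x hx => hUs hx⟩
  -- The denominator is treated as an integral over `σ`, where the maximum of the limit sits at `ν`.
  -- Laplace's principle then needs mass near `ν`, which is why `ν` is taken in the support.
  have hσU : ∀ U ∈ 𝓝 ν, 0 < m (U ∩ σ) := fun U hU => by
    rw [← Measure.restrict_apply' hσ.measurableSet, hσm]
    exact (Measure.mem_support_iff_forall ν).1 hνm U hU
  obtain ⟨y, hy, hmax, he⟩ := exists_relativeEntropy_eq hV hf hν hC hCne hCσ
  have hposC : ∀ k, 0 < ∫ ν' in C, ∏ j ∈ Finset.range k, likelihood V (ξ j) ν' ∂m :=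
    setIntegral_prod_likelihood_pos hV
      (by simpa using hCm y hy Set.univ univ_mem) fun j ν' hν' => hpos j ν' (hCσ hν')
  have hposσ : ∀ k, 0 < ∫ ν' in σ, ∏ j ∈ Finset.range k, likelihood V (ξ j) ν' ∂m :=
    setIntegral_prod_likelihood_pos hV
      (by simpa using hσU Set.univ univ_mem) hpos
  have hl1 := tendsto_log_setIntegral_exp (m := m) hC.measurableSet
    (fun k => (integrable_prod_likelihood hV m ξ k).integrableOn) (hξ.mono hCσ)
    (fun k ν' hν' => prod_likelihood_eq_exp (fun j => hpos j ν' (hCσ hν')) k)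
    (fun ν' hν' => hmax hν') (hball hC.isClosed hCσ hy (hCm y hy))
  have hl2 := tendsto_log_setIntegral_exp (m := m) hσ.measurableSet
    (fun k => (integrable_prod_likelihood hV m ξ k).integrableOn) hξ
    (fun k ν' hν' => prod_likelihood_eq_exp (fun j => hpos j ν' hν') k)
    (fun ν' hν' => by
      rcases eq_or_ne ν' ν with rfl | hne
      · exact le_rfl
      · exact (expectedLog_lt hV hf hν hν' hne).le) (hball hσ.isClosed subset_rfl hν hσU)
  rw [hσm] at hl2 hposσ
  refine ⟨fun k => div_pos (hposC k) (hposσ k), ?_⟩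
  rw [he]
  refine (hl2.sub hl1).congr fun k => ?_
  rw [Real.log_div (hposC k).ne' (hposσ k).ne']
  ring

theorem measurable_integral_prod_likelihood (hV : IsJumpFamily μ V) (m : Measure ℝ)
    [IsFiniteMeasure m] (k : ℕ) :
    Measurable fun ξ : ℕ → X => ∫ ν, ∏ j ∈ Finset.range k, likelihood V (ξ j) ν ∂m := by
  have hm : Measurable fun p : (ℕ → X) × ℝ => ∏ j ∈ Finset.range k, likelihood V (p.1 j) p.2 :=
    Finset.measurable_fun_prod _ fun j _ =>
      hV.measurable_likelihood.comp (f := fun p : (ℕ → X) × ℝ => (p.1 j, p.2))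
        (((measurable_pi_apply j).comp measurable_fst).prodMk measurable_snd)
  exact hm.stronglyMeasurable.integral_prod_right.measurable

end Posterior

end NonDemolition

/-! ### The main theorem -/

theorem theorem2p2 {H : Type*} [NormedAddCommGroup H] [InnerProductSpace ℂ H] [CompleteSpace H]
    [TopologicalSpace.SeparableSpace H]
    {X : Type*} [MeasurableSpace X] (μ : Measure X) [SigmaFinite μ]
    (N : H →L[ℂ] H) (hN : IsSelfAdjoint N)
    (V : X → ℝ → ℂ) (hV : NonDemolition.IsJumpFamily μ V)
    (ρ : H →L[ℂ] H) (hρ : NonDemolition.IsDensityMatrix ρ)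
    (hf : NonDemolition.LikelihoodAssumption μ V (spectrum ℝ N))
    (Nhat : ℕ → (ℕ → X) → ℝ)
    (hNhat : NonDemolition.IsMaximumLikelihoodEstimator V (spectrum ℝ N) Nhat) :
    NonDemolition.IsOutcomeLaw N hN μ V ρ (NonDemolition.outcomeLaw N hN μ V ρ) ∧
    ∃ Ninf : (ℕ → X) → ℝ, Measurable Ninf ∧
      (∀ᵐ ξ ∂(NonDemolition.outcomeLaw N hN μ V ρ),
        Tendsto (fun k => Nhat k ξ) atTop (𝓝 (Ninf ξ))) ∧
      (∀ B : Set ℝ, MeasurableSet B →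
        (((NonDemolition.outcomeLaw N hN μ V ρ).real {ξ | Ninf ξ ∈ B} : ℝ) : ℂ) =
          NonDemolition.trace (NonDemolition.spectralProjection N hN B * ρ)) ∧
      (∀ O : Set ℝ, (∃ U : Set ℝ, IsOpen U ∧ O = U ∩ spectrum ℝ N) → O.Nonempty →
        closure O ⊆ (NonDemolition.stateSpectralMeasure N hN ρ).support →
        ∀ᵐ ξ ∂(NonDemolition.outcomeLaw N hN μ V ρ),
          (∀ k, 0 < (NonDemolition.trace (NonDemolition.spectralProjection N hN (closure O) *
            NonDemolition.posterior N hN V ρ k ξ)).re) ∧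
          Tendsto (fun k : ℕ => -((1 / k : ℝ) * Real.log
            (NonDemolition.trace (NonDemolition.spectralProjection N hN (closure O) *
              NonDemolition.posterior N hN V ρ k ξ)).re)) atTop
            (𝓝 (NonDemolition.relativeEntropy μ V (Ninf ξ) (closure O)))) := by
  have hcs : CompactSpace (spectrum ℝ N) := NonDemolition.compactSpace_spectrum N
  have hσ : IsCompact (spectrum ℝ N) := spectrum.isCompact N
  have hprob := NonDemolition.isProbabilityMeasure_stateSpectralMeasure hN hρ
  have hσae := NonDemolition.ae_mem_spectrum hN hρ
  have hcons : ∀ᵐ ν ∂(NonDemolition.stateSpectralMeasure N hN ρ),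
      ∀ᵐ ξ ∂(NonDemolition.sequenceLaw μ V hV ν), Tendsto (fun k => Nhat k ξ) atTop (𝓝 ν) :=
    hσae.mono fun ν hν => NonDemolition.ae_tendsto_maximumLikelihoodEstimator hV hf hNhat hν
  -- Nothing is assumed about `Nhat 0`, hence the shift by one.
  have hmeas : ∀ k, Measurable (Nhat (k + 1)) := fun k => (hNhat (k + 1) (by omega)).1
  have hconv : ∀ᵐ ξ ∂(NonDemolition.outcomeLaw N hN μ V ρ),
      ∃ l, Tendsto (fun k => Nhat (k + 1) ξ) atTop (𝓝 l) := by
    refine NonDemolition.ae_outcomeLaw_of_ae hN hV hρ (measurableSet_exists_tendsto hmeas) ?_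
    filter_upwards [hcons] with ν hν
    filter_upwards [hν] with ξ hξ
    exact ⟨ν, hξ.comp (tendsto_add_atTop_nat 1)⟩
  obtain ⟨Ninf, hNm, hNt⟩ := measurable_limit_of_tendsto_metrizable_ae
    (fun k => (hmeas k).aemeasurable) hconv
  -- The limit recovers the hidden value: under `μ_ν^{⊗ℕ}` it equals `ν`. So the event `Ninf ∈ B`
  -- has conditional probability `1_B(ν)`, and `Ninf` has law `λ_ρ`.
  have hae : ∀ᵐ ν ∂(NonDemolition.stateSpectralMeasure N hN ρ),
      ∀ᵐ ξ ∂(NonDemolition.sequenceLaw μ V hV ν), Ninf ξ = ν := by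
    rw [NonDemolition.outcomeLaw_eq hN hV hρ] at hNt
    filter_upwards [hcons, Measure.ae_ae_of_ae_bind
      (NonDemolition.measurable_sequenceLaw hV).aemeasurable hNt] with ν h1 h2
    filter_upwards [h1, h2] with ξ h3 h4
    exact tendsto_nhds_unique h4 (h3.comp (tendsto_add_atTop_nat 1))
  refine ⟨NonDemolition.isOutcomeLaw_outcomeLaw hN hV hρ, Ninf, hNm, ?_, fun B hB => ?_, ?_⟩
  · filter_upwards [hNt] with ξ hξ
    exact (tendsto_add_atTop_iff_nat 1).1 hξ
  · rw [NonDemolition.trace_spectralProjection_mul hN hρ hB]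
    congr 1
    rw [measureReal_def, measureReal_def, NonDemolition.outcomeLaw_eq hN hV hρ,
      Measure.bind_apply (s := {ξ | Ninf ξ ∈ B}) (hNm hB)
        (NonDemolition.measurable_sequenceLaw hV).aemeasurable, ← lintegral_indicator_one hB]
    congr 1
    refine lintegral_congr_ae (hae.mono fun ν hν => ?_)
    by_cases h : ν ∈ B
    · rw [Set.indicator_of_mem h, Pi.one_apply]
      exact (mem_ae_iff_prob_eq_one (hNm hB)).1 (hν.mono fun ξ hξ => by
        rwa [hξ])
    · rw [Set.indicator_of_notMem h]
      exact measure_eq_zero_iff_ae_notMem.2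
        (hν.mono fun ξ hξ => by rwa [Set.mem_ofPred_eq, hξ])
  · rintro O ⟨U, hU, hOU⟩ hOne hOs
    have hCσ : closure O ⊆ spectrum ℝ N :=
      closure_minimal (hOU ▸ Set.inter_subset_right) hσ.isClosed
    have hC : IsCompact (closure O) := hσ.of_isClosed_subset isClosed_closure hCσ
    -- A neighbourhood of a point of the closure meets `O` at some `z` in the support. Near `z` the
    -- set `O` is the whole spectrum, which carries all the mass.
    have hCm : ∀ y ∈ closure O, ∀ W ∈ 𝓝 y,
        0 < NonDemolition.stateSpectralMeasure N hN ρ (W ∩ closure O) := fun y hy W hW => by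
      obtain ⟨W', hW'W, hW'o, hyW'⟩ := mem_nhds_iff.1 hW
      obtain ⟨z, hzW', hzO⟩ := mem_closure_iff.1 hy W' hW'o hyW'
      have hzU : z ∈ U := (hOU ▸ hzO : z ∈ U ∩ spectrum ℝ N).1
      have h1 := (Measure.mem_support_iff_forall z).1 (hOs (subset_closure hzO)) (W' ∩ U)
        ((hW'o.inter hU).mem_nhds ⟨hzW', hzU⟩)
      rw [← Measure.restrict_eq_self_of_ae_mem hσae, Measure.restrict_apply' hσ.measurableSet] at h1
      refine h1.trans_le (measure_mono fun x hx => ⟨hW'W hx.1.1, subset_closure ?_⟩)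
      rw [hOU]
      exact ⟨hx.1.2, hx.2⟩
    obtain ⟨s, hsm, hs⟩ := NonDemolition.exists_measurable_relativeEntropy hV hf hC hOne.closure hCσ
    simp only [NonDemolition.trace_spectralProjection_mul_posterior hN hV hρ _ _
      isClosed_closure.measurableSet]
    set Z : ℕ → (ℕ → X) → ℝ := fun k ξ =>
      (∫ ν in closure O, ∏ j ∈ Finset.range k, NonDemolition.likelihood V (ξ j) ν
        ∂(NonDemolition.stateSpectralMeasure N hN ρ)) /
      ∫ ν, ∏ j ∈ Finset.range k, NonDemolition.likelihood V (ξ j) ν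
        ∂(NonDemolition.stateSpectralMeasure N hN ρ) with hZ
    have hZm : ∀ k, Measurable (Z k) := fun k =>
      (NonDemolition.measurable_integral_prod_likelihood hV _ k).div
        (NonDemolition.measurable_integral_prod_likelihood hV _ k)
    -- Subtracting the measurable `s (Ninf ξ)` turns the claim into convergence to the constant `0`,
    -- a measurable event. Membership of `Ninf ξ` in the spectrum is kept in order to return from
    -- `s` to the relative entropy.
    have key : ∀ᵐ ξ ∂(NonDemolition.outcomeLaw N hN μ V ρ), Ninf ξ ∈ spectrum ℝ N ∧
        (∀ k, 0 < Z k ξ) ∧ Tendsto (fun k : ℕ => -((1 / k : ℝ) * Real.log (Z k ξ)) - s (Ninf ξ))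
          atTop (𝓝 0) := by
      refine NonDemolition.ae_outcomeLaw_of_ae hN hV hρ ?_ ?_
      · have h1 : MeasurableSet {ξ | Ninf ξ ∈ spectrum ℝ N} := hNm hσ.measurableSet
        have h2 : MeasurableSet {ξ | ∀ k, 0 < Z k ξ} := by
          rw [Set.ofPred_forall]
          exact MeasurableSet.iInter fun k => measurableSet_lt measurable_const (hZm k)
        have h3 : MeasurableSet {ξ | Tendsto
            (fun k : ℕ => -((1 / k : ℝ) * Real.log (Z k ξ)) - s (Ninf ξ)) atTop (𝓝 0)} :=
          measurableSet_tendsto _ fun k => (((hZm k).log.const_mul _).neg).sub (hsm.comp hNm)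
        exact h1.inter (h2.inter h3)
      · filter_upwards [hσae, hae, Measure.support_mem_ae] with ν hν hνN hνs
        filter_upwards [hνN, NonDemolition.ae_tendstoUniformlyOn_log_likelihood hV hf hν]
          with ξ hξN ⟨hpos, hξ⟩
        obtain ⟨h1, h2⟩ := NonDemolition.tendsto_log_posterior hV hf hσae hC hOne.closure hCσ hCm
          hν hνs hpos hξ
        rw [hξN]
        refine ⟨hν, h1, ?_⟩
        rw [← hs ν hν] at h2
        simpa using h2.sub_const (s ν)
    filter_upwards [key] with ξ ⟨h1, h2, h3⟩
    refine ⟨h2, ?_⟩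
    rw [← hs _ h1]
    simpa using h3.add_const (s (Ninf ξ))
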